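/- Manifolds are smooth, Hausdorff, second countable and without boundary. A weakly-embedded submanifold of a manifold $M$ is a subset $L \subseteq M$ with a manifold structure for which the inclusion $L \hookrightarrow M$ is an immersion and for which a map from an open subset of some $\mathbb{R}^d$ to $L$ is smooth if and only if it is smooth as a map to $M$. A (Stefan) singular foliation of an $n$-dimensional manifold $M$ is a partition $\mathcal{F}$ of $M$ into connected weakly-embedded submanifolds, called leaves, such that about each $x \in M$, with $k$ the dimension of the leaf through $x$, there is a diffeomorphism $\psi : V \to U \times W$ from an open neighbourhood $V$ of $x$ onto a product of open neighbourhoods of the origin in $\mathbb{R}^k$ and $\mathbb{R}^{n-k}$, with $\psi(x) = (0,0)$, such that for each leaf $L$ we have $\psi(L \cap V) = U \times \ell$ for some $\ell \subseteq W$. A vector field is tangent to $\mathcal{F}$ if its value at each point is tangent to the leaf through that point. A differential form $\alpha$ on $M$ is $\mathcal{F}$-basic if $\iota_X \alpha = 0$ and $\mathcal{L}_X \alpha = 0$ for every smooth vector field $X$ tangent to $\mathcal{F}$. The basic forms are a subcomplex $(\Omega_b^\bullet(M,\mathcal{F}), d)$ of the de Rham complex of $M$; its cohomology $H_b^\bullet(M,\mathcal{F})$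 is the basic cohomology. If $p : M \to N$ is a surjective submersion with connected fibers and $\mathcal{F}$ is a singular foliation of $N$, then $p^{-1}\mathcal{F}$ is the partition of $M$ into the sets $p^{-1}(L)$, for $L$ a leaf of $\mathcal{F}$. Two singular foliations $(N_0, \mathcal{F}_0)$ and $(N_1, \mathcal{F}_1)$ are Molino transverse equivalent if there are a singular foliation $(M, \mathcal{F})$ and surjective submersions with connected fibers $p_i : M \to N_i$ such that $p_i^{-1}\mathcal{F}_i = \mathcal{F}$ for $i = 0, 1$. (1) Let $p : M \to N$ be a surjective submersion with connected fibers, and let $\mathcal{F}$ be a singular foliation of $N$. Then the pullback $p^*$ of forms is an isomorphism of complexes from $\Omega_b^\bullet(N, \mathcal{F})$ to $\Omega_b^\bullet(M, p^{-1}\mathcal{F})$. (2) If the singular foliations $(N_0, \mathcal{F}_0)$ and $(N_1, \mathcal{F}_1)$ are Molino transverse equivalent, then the complexes $\Omega_b^\bullet(N_0, \mathcal{F}_0)$ and $\Omega_b^\bullet(N_1, \mathcal{F}_1)$ are isomorphic, and so $H_b^k(N_0, \mathcal{F}_0) \cong H_b^k(N_1, \mathcal{F}_1)$ for every $k \geq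 0$. -/

import Mathlib

open scoped Manifold ContDiff Topology

universe u

set_option linter.unusedSectionVars false

noncomputable section

namespace Foliation

/-- Differential `k`-forms on the `n`-manifold `M`, before any smoothness is imposed: a choice of
an alternating `k`-linear form on each tangent space. -/
abbrev RawForm (n : ℕ) (M : Type u) [TopologicalSpace M] [ChartedSpace (EuclideanSpace ℝ (Fin n)) M]
    (k : ℕ) : Type u :=
  ∀ x : M, TangentSpace (𝓡 n) x [⋀^Fin k]→L[ℝ] ℝ

section
variable {n : ℕ} {M : Type u} [TopologicalSpace M] [ChartedSpace (EuclideanSpace ℝ (Fin n)) M]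

/-- The expression of a form in the preferred chart at `c`: its pullback by the inverse chart,
a form on the model space, meaningful on the target of the chart. -/
def chartRep {k : ℕ} (α : RawForm n M k) (c : M) :
    EuclideanSpace ℝ (Fin n) → EuclideanSpace ℝ (Fin n) [⋀^Fin k]→L[ℝ] ℝ := fun y =>
  (α ((extChartAt (𝓡 n) c).symm y)).compContinuousLinearMap
    (mfderiv 𝓘(ℝ, EuclideanSpace ℝ (Fin n)) (𝓡 n) (extChartAt (𝓡 n) c).symm y)

/-- A form is smooth if its expression in each preferred chart is smooth. -/
def IsSmoothForm {k : ℕ} (α : RawForm n M k) : Prop :=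
  ∀ c : M, ContDiffOn ℝ ∞ (chartRep α c) (extChartAt (𝓡 n) c).target

/-- The exterior derivative: at `x`, differentiate the expression of the form in the chart at `x`
and transport the result back by the derivative of the chart. By `chartRep_rawD` below, any other
chart gives the same result. -/
def rawD {k : ℕ} (α : RawForm n M k) : RawForm n M (k + 1) := fun x =>
  (extDeriv (chartRep α x) (extChartAt (𝓡 n) x x)).compContinuousLinearMap
    (mfderiv (𝓡 n) 𝓘(ℝ, EuclideanSpace ℝ (Fin n)) (extChartAt (𝓡 n) x) x)

theorem chartRep_apply {k : ℕ} (α : RawForm n M k) (c : M) (y : EuclideanSpace ℝ (Fin n))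
    (v : Fin k → EuclideanSpace ℝ (Fin n)) :
    chartRep α c y v = α ((extChartAt (𝓡 n) c).symm y) (fun i =>
    mfderiv 𝓘(ℝ, EuclideanSpace ℝ (Fin n)) (𝓡 n) (extChartAt (𝓡 n) c).symm y (v i)) := rfl

theorem chartRep_add {k : ℕ} (α η : RawForm n M k) (c : M) :
    chartRep (α + η) c = chartRep α c + chartRep η c := rfl

theorem chartRep_smul {k : ℕ} (a : ℝ) (α : RawForm n M k) (c : M) :
    chartRep (a • α) c = a • chartRep α c := rfl

/-- The pullback of a raw form by a map from the model space, at a point. -/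
def pullAt {k : ℕ} (α : RawForm n M k) (g : EuclideanSpace ℝ (Fin n) → M)
    (y : EuclideanSpace ℝ (Fin n)) : EuclideanSpace ℝ (Fin n) [⋀^Fin k]→L[ℝ] ℝ :=
  (α (g y)).compContinuousLinearMap (mfderiv 𝓘(ℝ, EuclideanSpace ℝ (Fin n)) (𝓡 n) g y)

theorem pullAt_congr {k : ℕ} (α : RawForm n M k) {g g' : EuclideanSpace ℝ (Fin n) → M}
    {y : EuclideanSpace ℝ (Fin n)} (h : g =ᶠ[𝓝 y] g') : pullAt α g y = pullAt α g' y := by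
  have key : ∀ (F : M → (Fin k → EuclideanSpace ℝ (Fin n)) → ℝ) (a b : M) (_ : a = b)
      (A B : EuclideanSpace ℝ (Fin n) →L[ℝ] EuclideanSpace ℝ (Fin n)) (_ : A = B)
      (v : Fin k → EuclideanSpace ℝ (Fin n)),
      F a (fun i => A (v i)) = F b (fun i => B (v i)) := by
    rintro F a _ rfl A _ rfl v
    rfl
  ext v
  exact key (fun a w => α a w) _ _ h.eq_of_nhds _ _ h.mfderiv_eq v

theorem IsSmoothForm.differentiableAt {k : ℕ} {α : RawForm n M k} (hα : IsSmoothForm α) (c : M)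
    {y : EuclideanSpace ℝ (Fin n)} (hy : y ∈ (extChartAt (𝓡 n) c).target) :
    DifferentiableAt ℝ (chartRep α c) y :=
  ((hα c).contDiffAt ((isOpen_extChartAt_target c).mem_nhds hy)).differentiableAt (by simp)

theorem rawD_smul {k : ℕ} (a : ℝ) (α : RawForm n M k) : rawD (a • α) = a • rawD α := by
  funext x
  have h : extDeriv (chartRep (a • α) x) (extChartAt (𝓡 n) x x) = _ :=
    extDeriv_smul a (chartRep α x)
  unfold rawD
  rw [h]
  rfl

variable [IsManifold (𝓡 n) ∞ M]

/-- The exterior derivative is computed by the Euclidean one in every chart. -/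
theorem chartRep_rawD {k : ℕ} {α : RawForm n M k} (hα : IsSmoothForm α) (c : M)
    {y : EuclideanSpace ℝ (Fin n)} (hy : y ∈ (extChartAt (𝓡 n) c).target) :
    chartRep (rawD α) c y = extDeriv (chartRep α c) y := by
  set z : M := (extChartAt (𝓡 n) c).symm y with hz
  set τ : EuclideanSpace ℝ (Fin n) → EuclideanSpace ℝ (Fin n) :=
    extChartAt (𝓡 n) z ∘ (extChartAt (𝓡 n) c).symm with hτ
  have hOc : IsOpen (extChartAt (𝓡 n) c).target := isOpen_extChartAt_target c
  have hev : ∀ᶠ y' in 𝓝 y, y' ∈ (extChartAt (𝓡 n) c).target ∧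
      (extChartAt (𝓡 n) c).symm y' ∈ (extChartAt (𝓡 n) z).source := by
    refine (hOc.eventually_mem hy).and ?_
    have hc : ContinuousAt (extChartAt (𝓡 n) c).symm y :=
      (contMDiffOn_extChartAt_symm (I := 𝓡 n) (n := ∞) c).continuousOn.continuousAt
        (hOc.mem_nhds hy)
    refine hc.eventually_mem ?_
    exact (isOpen_extChartAt_source z).mem_nhds (mem_extChartAt_source z)
  have hsm : ∀ y', y' ∈ (extChartAt (𝓡 n) c).target →
      MDifferentiableAt 𝓘(ℝ, EuclideanSpace ℝ (Fin n)) (𝓡 n) (extChartAt (𝓡 n) c).symm y' := by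
    intro y' hy'
    exact ((contMDiffOn_extChartAt_symm (n := ∞) c).contMDiffAt (hOc.mem_nhds hy')).mdifferentiableAt
      (by simp)
  have hch : ∀ x, x ∈ (extChartAt (𝓡 n) z).source →
      MDifferentiableAt (𝓡 n) 𝓘(ℝ, EuclideanSpace ℝ (Fin n)) (extChartAt (𝓡 n) z) x := by
    intro x hx
    exact mdifferentiableAt_extChartAt (by simpa using hx)
  have hτs : ∀ y', y' ∈ (extChartAt (𝓡 n) c).target →
      (extChartAt (𝓡 n) c).symm y' ∈ (extChartAt (𝓡 n) z).source → ContDiffAt ℝ ∞ τ y' := by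
    intro y' h1 h2
    rw [← contMDiffAt_iff_contDiffAt]
    exact ((contMDiffOn_extChartAt (n := ∞) (x := z)).contMDiffAt
      ((chartAt (EuclideanSpace ℝ (Fin n)) z).open_source.mem_nhds (by simpa using h2))).comp y'
      ((contMDiffOn_extChartAt_symm (n := ∞) c).contMDiffAt (hOc.mem_nhds h1))
  have hrep : chartRep α c =ᶠ[𝓝 y] fun y' =>
      (chartRep α z (τ y')).compContinuousLinearMap (fderiv ℝ τ y') := by
    filter_upwards [hev, hev.eventually_nhds] with y' hy' hyn
    have h3 : (extChartAt (𝓡 n) z).symm (τ y') = (extChartAt (𝓡 n) c).symm y' :=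
      (extChartAt (𝓡 n) z).left_inv hy'.2
    have hτy : τ y' ∈ (extChartAt (𝓡 n) z).target := (extChartAt (𝓡 n) z).map_source hy'.2
    have hz' : MDifferentiableAt 𝓘(ℝ, EuclideanSpace ℝ (Fin n)) (𝓡 n)
        (extChartAt (𝓡 n) z).symm (τ y') :=
      ((contMDiffOn_extChartAt_symm (n := ∞) z).contMDiffAt
        ((isOpen_extChartAt_target z).mem_nhds hτy)).mdifferentiableAt (by simp)
    have hτd : MDifferentiableAt 𝓘(ℝ, EuclideanSpace ℝ (Fin n)) 𝓘(ℝ, EuclideanSpace ℝ (Fin n)) τ y' :=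
      ((hτs y' hy'.1 hy'.2).differentiableAt (by simp)).mdifferentiableAt
    have hcomp := mfderiv_comp y' hz' hτd
    rw [mfderiv_eq_fderiv] at hcomp
    have hee : (extChartAt (𝓡 n) c).symm =ᶠ[𝓝 y'] (extChartAt (𝓡 n) z).symm ∘ τ := by
      filter_upwards [hyn] with w hw
      exact ((extChartAt (𝓡 n) z).left_inv hw.2).symm
    refine (pullAt_congr α hee).trans ?_
    unfold pullAt
    rw [hcomp]
    rfl
  have hD : fderiv ℝ τ y = (mfderiv (𝓡 n) 𝓘(ℝ, EuclideanSpace ℝ (Fin n)) (extChartAt (𝓡 n) z) z).comp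
      (mfderiv 𝓘(ℝ, EuclideanSpace ℝ (Fin n)) (𝓡 n) (extChartAt (𝓡 n) c).symm y) := by
    rw [← mfderiv_eq_fderiv]
    exact mfderiv_comp y (hch _ (mem_extChartAt_source z)) (hsm y hy)
  have hdiff : DifferentiableAt ℝ (chartRep α z) (τ y) :=
    ((hα z).contDiffAt ((isOpen_extChartAt_target z).mem_nhds (mem_extChartAt_target z))).differentiableAt
      (by simp)
  rw [hrep.extDeriv_eq, extDeriv_pullback hdiff (hτs y hy (mem_extChartAt_source z)) (by simpa using WithTop.coe_le_coe.2 (le_top : (2 : ℕ∞) ≤ ⊤)), hD]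
  rfl



theorem IsSmoothForm.rawD {k : ℕ} {α : RawForm n M k} (hα : IsSmoothForm α) :
    IsSmoothForm (rawD α) := by
  intro c
  have h1 : ContDiffOn ℝ ∞ (fderiv ℝ (chartRep α c)) (extChartAt (𝓡 n) c).target :=
    (hα c).fderiv_of_isOpen (isOpen_extChartAt_target c) (by simp)
  have h2 := (ContinuousAlternatingMap.alternatizeUncurryFinCLM (n := k) ℝ
    (EuclideanSpace ℝ (Fin n)) ℝ).contDiff (n := ∞) |>.comp_contDiffOn h1
  exact h2.congr fun y hy => chartRep_rawD hα c hy

theorem rawD_rawD {k : ℕ} {α : RawForm n M k} (hα : IsSmoothForm α) :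
    rawD (rawD α) = 0 := by
  funext x
  have hx := mem_extChartAt_target (I := 𝓡 n) x
  have hev : chartRep (rawD α) x =ᶠ[𝓝 (extChartAt (𝓡 n) x x)] extDeriv (chartRep α x) := by
    filter_upwards [(isOpen_extChartAt_target x).mem_nhds hx] with y hy
    exact chartRep_rawD hα x hy
  have h0 : extDeriv (chartRep (rawD α) x) (extChartAt (𝓡 n) x x) = 0 := by
    rw [hev.extDeriv_eq]
    exact extDeriv_extDeriv_apply
      ((hα x).contDiffAt ((isOpen_extChartAt_target x).mem_nhds hx))
      (by simpa using WithTop.coe_le_coe.2 (le_top : (2 : ℕ∞) ≤ ⊤))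
  ext v
  change extDeriv (chartRep (rawD α) x) (extChartAt (𝓡 n) x x) _ = 0
  rw [h0]
  rfl

theorem rawD_add {k : ℕ} {α β : RawForm n M k} (hα : IsSmoothForm α) (hβ : IsSmoothForm β) :
    rawD (α + β) = rawD α + rawD β := by
  funext x
  have hx := mem_extChartAt_target (I := 𝓡 n) x
  have h : extDeriv (chartRep (α + β) x) (extChartAt (𝓡 n) x x) = _ :=
    extDeriv_add (hα.differentiableAt x hx) (hβ.differentiableAt x hx)
  unfold rawD
  rw [h]
  rfl

end

section
variable {n : ℕ} {M : Type u} [TopologicalSpace M] [ChartedSpace (EuclideanSpace ℝ (Fin n)) M]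
  [IsManifold (𝓡 n) ∞ M]

/-- Vector fields on `M`, before any smoothness is imposed. -/
abbrev VField (n : ℕ) (M : Type u) [TopologicalSpace M]
    [ChartedSpace (EuclideanSpace ℝ (Fin n)) M] : Type u :=
  ∀ x : M, TangentSpace (𝓡 n) x

/-- Smooth vector fields: smooth sections of the tangent bundle. -/
def IsSmoothField (X : VField n M) : Prop :=
  ContMDiff (𝓡 n) (𝓡 n).tangent ∞ fun x => (⟨x, X x⟩ : TangentBundle (𝓡 n) M)

/-- `ι_X α = 0`; for a `0`-form the contraction is zero by convention. -/
def ContractionVanishes (X : VField n M) : ∀ {k : ℕ}, RawForm n M k → Prop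
  | 0, _ => True
  | k + 1, α => ∀ (x : M) (v : Fin k → TangentSpace (𝓡 n) x),
      α x (Fin.cons (X x) v : Fin (k + 1) → TangentSpace (𝓡 n) x) = 0

/-- The Lie derivative of a form along a vector field on a normed space, in coordinates:
`(L_X a) (v₁, …, vₖ) = (D_X a) (v₁, …, vₖ) + ∑ i, a (v₁, …, D_{v_i} X, …, vₖ)`. -/
def modelLie {V : Type*} [NormedAddCommGroup V] [NormedSpace ℝ V] {k : ℕ}
    (X : V → V) (a : V → V [⋀^Fin k]→L[ℝ] ℝ) (y : V) (v : Fin k → V) : ℝ :=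
  fderiv ℝ a y (X y) v + ∑ i, a y (Function.update v i (fderiv ℝ X y (v i)))

/-- The expression of a vector field in the preferred chart at `c`: its pullback by the inverse
chart. -/
def fieldRep (X : VField n M) (c : M) : EuclideanSpace ℝ (Fin n) → EuclideanSpace ℝ (Fin n) :=
  VectorField.mpullback 𝓘(ℝ, EuclideanSpace ℝ (Fin n)) (𝓡 n) (extChartAt (𝓡 n) c).symm X

/-- The Lie derivative `L_X α` of a form along a vector field: at `x`, it is computed in the chart
at `x` by the coordinate formula. -/
def lieD {k : ℕ} (X : VField n M) (α : RawForm n M k) (x : M)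
    (v : Fin k → TangentSpace (𝓡 n) x) : ℝ :=
  modelLie (fieldRep X x) (chartRep α x) (extChartAt (𝓡 n) x x) fun i =>
    mfderiv (𝓡 n) 𝓘(ℝ, EuclideanSpace ℝ (Fin n)) (extChartAt (𝓡 n) x) x (v i)

theorem modelLie_add {V : Type*} [NormedAddCommGroup V] [NormedSpace ℝ V] {k : ℕ}
    (X : V → V) {a b : V → V [⋀^Fin k]→L[ℝ] ℝ} {y : V} (ha : DifferentiableAt ℝ a y)
    (hb : DifferentiableAt ℝ b y) (v : Fin k → V) :
    modelLie X (a + b) y v = modelLie X a y v + modelLie X b y v := by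
  simp only [modelLie]
  rw [fderiv_add ha hb]
  simp only [Pi.add_apply, ContinuousAlternatingMap.add_apply, Finset.sum_add_distrib,
    add_apply]
  ring

theorem modelLie_smul {V : Type*} [NormedAddCommGroup V] [NormedSpace ℝ V] {k : ℕ}
    (X : V → V) (r : ℝ) {a : V → V [⋀^Fin k]→L[ℝ] ℝ} {y : V} (ha : DifferentiableAt ℝ a y)
    (v : Fin k → V) : modelLie X (r • a) y v = r * modelLie X a y v := by
  simp only [modelLie]
  rw [fderiv_const_smul ha]
  simp [mul_add, Finset.mul_sum]

/-- The formula `ι_X (d a) = L_X a` when `ι_X a = 0`. -/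
theorem modelLie_eq {V : Type*} [NormedAddCommGroup V] [NormedSpace ℝ V] {k : ℕ}
    {X : V → V} {a : V → V [⋀^Fin (k + 1)]→L[ℝ] ℝ} {y : V} (hX : DifferentiableAt ℝ X y)
    (ha : DifferentiableAt ℝ a y)
    (h0 : ∀ᶠ z in 𝓝 y, ∀ v : Fin k → V, a z (Fin.cons (X z) v : Fin (k + 1) → V) = 0)
    (v : Fin (k + 1) → V) :
    extDeriv a y (Fin.cons (X y) v : Fin (k + 2) → V) = modelLie X a y v := by
  have hd : ∀ i : Fin (k + 1), fderiv ℝ a y (v i) (Fin.cons (X y) (i.removeNth v)) =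
      - a y (Fin.cons (fderiv ℝ X y (v i)) (i.removeNth v)) := by
    intro i
    have hg : ∀ j : Fin (k + 1), DifferentiableAt ℝ
        (fun z => (Fin.cons (X z) (i.removeNth v) : Fin (k + 1) → V) j) y := by
      intro j
      refine Fin.cases ?_ (fun j => ?_) j
      · simpa using hX
      · simp
    have h1 := fderiv_continuousAlternatingMap_apply_apply ha hg (v i)
    have h2 : (fun z => a z fun j => (Fin.cons (X z) (i.removeNth v) : Fin (k + 1) → V) j)
        =ᶠ[𝓝 y] fun _ => 0 := by
      filter_upwards [h0] with z hz using hz _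
    rw [h2.fderiv_eq, Fin.sum_univ_succ] at h1
    simp only [Fin.cons_zero, Fin.cons_succ, fderiv_fun_const, Pi.zero_apply, zero_apply,
      Fin.update_cons_zero] at h1
    have h3 : ∀ j : Fin k, a y (Function.update (Fin.cons (X y) (i.removeNth v) : Fin (k + 1) → V)
        j.succ 0) = 0 := fun j => (a y).map_update_zero _ _
    simp only [h3, Finset.sum_const_zero, add_zero] at h1
    exact eq_neg_of_add_eq_zero_left h1.symm
  rw [extDeriv, ContinuousAlternatingMap.alternatizeUncurryFin_apply, Fin.sum_univ_succ]
  unfold modelLie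
  congr 1
  · simp
  · refine Finset.sum_congr rfl fun i _ => ?_
    have hr : Fin.removeNth i.succ (Fin.cons (X y) v : Fin (k + 2) → V) =
        (Fin.cons (X y) (i.removeNth v) : Fin (k + 1) → V) := by
      funext j
      refine Fin.cases ?_ (fun j => ?_) j <;> simp [Fin.removeNth]
    rw [hr, Fin.cons_succ, hd, ← Fin.insertNth_removeNth, ContinuousAlternatingMap.map_insertNth,
      Fin.val_succ, pow_succ]
    simp [Matrix.vecCons]


theorem isInvertible_symm (c : M) {y : EuclideanSpace ℝ (Fin n)}
    (hy : y ∈ (extChartAt (𝓡 n) c).target) :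
    (mfderiv 𝓘(ℝ, EuclideanSpace ℝ (Fin n)) (𝓡 n) (extChartAt (𝓡 n) c).symm y).IsInvertible := by
  have h := isInvertible_mfderivWithin_extChartAt_symm (I := 𝓡 n) hy
  rwa [ModelWithCorners.range_eq_univ, mfderivWithin_univ] at h

theorem chartRep_cons {k : ℕ} (α : RawForm n M (k + 1)) (X : VField n M) (c : M)
    {y : EuclideanSpace ℝ (Fin n)} (hy : y ∈ (extChartAt (𝓡 n) c).target)
    (v : Fin k → EuclideanSpace ℝ (Fin n)) :
    chartRep α c y (Fin.cons (fieldRep X c y) v : Fin (k + 1) → EuclideanSpace ℝ (Fin n)) =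
      α ((extChartAt (𝓡 n) c).symm y) (Fin.cons (X ((extChartAt (𝓡 n) c).symm y)) (fun i =>
        mfderiv 𝓘(ℝ, EuclideanSpace ℝ (Fin n)) (𝓡 n) (extChartAt (𝓡 n) c).symm y (v i)) :
        Fin (k + 1) → TangentSpace (𝓡 n) ((extChartAt (𝓡 n) c).symm y)) := by
  rw [chartRep_apply]
  congr 1
  funext i
  refine Fin.cases ?_ (fun j => ?_) i
  · exact (isInvertible_symm c hy).self_apply_inverse _
  · rfl

theorem fieldRep_self (X : VField n M) (x : M) :
    fieldRep X x (extChartAt (𝓡 n) x x) =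
      mfderiv (𝓡 n) 𝓘(ℝ, EuclideanSpace ℝ (Fin n)) (extChartAt (𝓡 n) x) x (X x) := by
  have h1 : ∀ v : TangentSpace (𝓡 n) x, (mfderiv 𝓘(ℝ, EuclideanSpace ℝ (Fin n)) (𝓡 n)
      (extChartAt (𝓡 n) x).symm (extChartAt (𝓡 n) x x)).inverse v = v := by
    have h := mfderivWithin_extChartAt_symm_inverse_apply (I := 𝓡 n) (x := x)
    rwa [ModelWithCorners.range_eq_univ, mfderivWithin_univ] at h
  have h2 : (X ((extChartAt (𝓡 n) x).symm (extChartAt (𝓡 n) x x)) : EuclideanSpace ℝ (Fin n)) =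
      X x := congrArg (fun a => (X a : EuclideanSpace ℝ (Fin n))) (extChartAt_to_inv x)
  rw [mfderiv_extChartAt_self]
  exact (h1 _).trans h2

theorem differentiableAt_fieldRep {X : VField n M} (hX : IsSmoothField X) (c : M)
    {y : EuclideanSpace ℝ (Fin n)} (hy : y ∈ (extChartAt (𝓡 n) c).target) :
    DifferentiableAt ℝ (fieldRep X c) y := by
  have h := ContMDiffAt.mpullback_vectorField_preimage (m := 1) (n := ∞)
    (I := 𝓘(ℝ, EuclideanSpace ℝ (Fin n))) (I' := 𝓡 n) (f := (extChartAt (𝓡 n) c).symm)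
    (x₀ := y) (V := X) ((hX _).of_le (by simp))
    ((contMDiffOn_extChartAt_symm (n := ∞) c).contMDiffAt
      ((isOpen_extChartAt_target c).mem_nhds hy)) (isInvertible_symm c hy) (by
        simpa using WithTop.coe_le_coe.2 (le_top : ((1 : ℕ∞) + 1) ≤ ⊤))
  exact (contMDiffAt_vectorSpace_iff_contDiffAt.1 h).differentiableAt (by simp)

theorem contractionVanishes_chart {k : ℕ} {α : RawForm n M (k + 1)} {X : VField n M}
    (h : ContractionVanishes X α) (c : M) :
    ∀ y ∈ (extChartAt (𝓡 n) c).target, ∀ v : Fin k → EuclideanSpace ℝ (Fin n),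
      chartRep α c y (Fin.cons (fieldRep X c y) v :
        Fin (k + 1) → EuclideanSpace ℝ (Fin n)) = 0 := fun y hy v => by
  rw [chartRep_cons α X c hy]
  exact h _ _

theorem modelLie_zero_form {V : Type*} [NormedAddCommGroup V] [NormedSpace ℝ V]
    {X : V → V} {a : V → V [⋀^Fin 0]→L[ℝ] ℝ} {y : V} (v : Fin 0 → V) :
    extDeriv a y (Fin.cons (X y) v : Fin 1 → V) = modelLie X a y v := by
  rw [extDeriv, ContinuousAlternatingMap.alternatizeUncurryFin_apply]
  simp [modelLie]

theorem rawD_cons {k : ℕ} {α : RawForm n M k} {X : VField n M} (hα : IsSmoothForm α)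
    (hX : IsSmoothField X) (h : ContractionVanishes X α) (x : M)
    (v : Fin k → TangentSpace (𝓡 n) x) :
    rawD α x (Fin.cons (X x) v : Fin (k + 1) → TangentSpace (𝓡 n) x) = lieD X α x v := by
  have hx := mem_extChartAt_target (I := 𝓡 n) x
  have h1 : ∀ w : Fin k → EuclideanSpace ℝ (Fin n),
      extDeriv (chartRep α x) (extChartAt (𝓡 n) x x) (Fin.cons (fieldRep X x
        (extChartAt (𝓡 n) x x)) w : Fin (k + 1) → EuclideanSpace ℝ (Fin n)) =
      modelLie (fieldRep X x) (chartRep α x) (extChartAt (𝓡 n) x x) w := by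
    intro w
    cases k with
    | zero => exact modelLie_zero_form w
    | succ k =>
      refine modelLie_eq (differentiableAt_fieldRep hX x hx) (hα.differentiableAt x hx) ?_ w
      filter_upwards [(isOpen_extChartAt_target x).mem_nhds hx] with y hy
      exact contractionVanishes_chart h x y hy
  refine Eq.trans ?_ (h1 fun i =>
    mfderiv (𝓡 n) 𝓘(ℝ, EuclideanSpace ℝ (Fin n)) (extChartAt (𝓡 n) x) x (v i))
  change extDeriv (chartRep α x) (extChartAt (𝓡 n) x x) _ = _
  congr 1
  funext i
  refine Fin.cases ?_ (fun j => ?_) i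
  · exact (fieldRep_self X x).symm
  · rfl

theorem contractionVanishes_rawD {k : ℕ} {α : RawForm n M k} {X : VField n M}
    (hα : IsSmoothForm α) (hX : IsSmoothField X) (h : ContractionVanishes X α)
    (hL : ∀ x v, lieD X α x v = 0) : ContractionVanishes X (rawD α) := fun x v => by
  rw [rawD_cons hα hX h, hL]

theorem lieD_rawD {k : ℕ} {α : RawForm n M k} {X : VField n M}
    (hα : IsSmoothForm α) (hX : IsSmoothField X) (h : ContractionVanishes X α)
    (hL : ∀ x v, lieD X α x v = 0) (x : M) (v : Fin (k + 1) → TangentSpace (𝓡 n) x) :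
    lieD X (rawD α) x v = 0 := by
  rw [← rawD_cons hα.rawD hX (contractionVanishes_rawD hα hX h hL), rawD_rawD hα]
  rfl

/-- The tangent space at `x` to the leaf of `F` through `x`: the velocities at `x` of smooth curves
of `M` that stay in the leaf. If the leaf is a weakly-embedded submanifold, this is the image of the
derivative of its inclusion, see `mem_leafTangent_iff`. Partitions are given as equivalence
relations; the leaf through `x` is `{y | F y x}`. -/
def leafTangent (n : ℕ) {M : Type u} [TopologicalSpace M]
    [ChartedSpace (EuclideanSpace ℝ (Fin n)) M] (F : Setoid M) (x : M) :
    Set (TangentSpace (𝓡 n) x) :=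
  {v | ∃ γ : ℝ → M, ContMDiff 𝓘(ℝ, ℝ) (𝓡 n) ∞ γ ∧ (∀ t, F (γ t) x) ∧
    tangentMap 𝓘(ℝ, ℝ) (𝓡 n) γ ⟨0, (1 : ℝ)⟩ = ⟨x, v⟩}

/-- Smooth vector fields tangent to `F`. -/
def IsTangentField (F : Setoid M) (X : VField n M) : Prop :=
  IsSmoothField X ∧ ∀ x, X x ∈ leafTangent n F x

/-- Basic forms: horizontal and invariant for every vector field tangent to `F`. -/
def IsBasic (F : Setoid M) {k : ℕ} (α : RawForm n M k) : Prop :=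
  ∀ X : VField n M, IsTangentField F X →
    ContractionVanishes X α ∧ ∀ x v, lieD X α x v = 0

theorem lieD_add {k : ℕ} {α β : RawForm n M k} (hα : IsSmoothForm α) (hβ : IsSmoothForm β)
    (X : VField n M) (x : M) (v : Fin k → TangentSpace (𝓡 n) x) :
    lieD X (α + β) x v = lieD X α x v + lieD X β x v := by
  exact modelLie_add _ (hα.differentiableAt x (mem_extChartAt_target x))
    (hβ.differentiableAt x (mem_extChartAt_target x)) _

theorem lieD_smul {k : ℕ} (a : ℝ) {α : RawForm n M k} (hα : IsSmoothForm α)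
    (X : VField n M) (x : M) (v : Fin k → TangentSpace (𝓡 n) x) :
    lieD X (a • α) x v = a * lieD X α x v := by
  exact modelLie_smul _ a (hα.differentiableAt x (mem_extChartAt_target x)) _

variable (n) in
/-- The smooth basic `k`-forms of a partition `F`. -/
def basicForms (F : Setoid M) (k : ℕ) : Submodule ℝ (RawForm n M k) where
  carrier := {α | IsSmoothForm α ∧ IsBasic F α}
  zero_mem' := by
    have h0 : ∀ c : M, chartRep (0 : RawForm n M k) c = 0 := fun c => rfl
    have hs : IsSmoothForm (0 : RawForm n M k) := fun c => by
      rw [h0]; exact contDiffOn_const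
    refine ⟨hs, fun X _ => ⟨?_, fun x v => ?_⟩⟩
    · cases k with
      | zero => trivial
      | succ k => exact fun x v => rfl
    · have h := lieD_smul 0 hs X x v
      rwa [zero_smul, zero_mul] at h
  add_mem' := by
    rintro α β ⟨hα, hα'⟩ ⟨hβ, hβ'⟩
    refine ⟨fun c => (hα c).add (hβ c), fun X hX => ⟨?_, fun x v => ?_⟩⟩
    · cases k with
      | zero => trivial
      | succ k =>
        intro x v
        change α x _ + β x _ = 0
        rw [(hα' X hX).1 x v, (hβ' X hX).1 x v, add_zero]
    · rw [lieD_add hα hβ, (hα' X hX).2, (hβ' X hX).2, add_zero]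
  smul_mem' := by
    rintro a α ⟨hα, hα'⟩
    refine ⟨fun c => (hα c).const_smul a, fun X hX => ⟨?_, fun x v => ?_⟩⟩
    · cases k with
      | zero => trivial
      | succ k =>
        intro x v
        change a • α x _ = 0
        rw [(hα' X hX).1 x v, smul_zero]
    · rw [lieD_smul a hα, (hα' X hX).2, mul_zero]

variable (n) in
/-- The exterior derivative restricts to basic forms. -/
def basicD (F : Setoid M) (k : ℕ) : basicForms n F k →ₗ[ℝ] basicForms n F (k + 1) where
  toFun α := ⟨rawD α.1, α.2.1.rawD, fun X hX =>
    ⟨contractionVanishes_rawD α.2.1 hX.1 (α.2.2 X hX).1 (α.2.2 X hX).2,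
      lieD_rawD α.2.1 hX.1 (α.2.2 X hX).1 (α.2.2 X hX).2⟩⟩
  map_add' α β := Subtype.ext (rawD_add α.2.1 β.2.1)
  map_smul' a α := Subtype.ext (rawD_smul a α.1)

open CategoryTheory in
variable (n) in
/-- The complex of basic forms, in degrees `0, 1, 2, …`, with the exterior derivative. -/
def basicComplex (F : Setoid M) : CochainComplex (ModuleCat.{u} ℝ) ℕ :=
  CochainComplex.of (fun k => ModuleCat.of ℝ (basicForms n F k))
    (fun k => ModuleCat.ofHom (basicD n F k)) fun k => by
      ext α
      exact congrArg (fun η : RawForm n M (k + 1 + 1) => η _ _) (rawD_rawD α.2.1)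

variable (n) in
/-- The basic cohomology in degree `k`. -/
def basicCohomology (F : Setoid M) (k : ℕ) : ModuleCat.{u} ℝ :=
  (basicComplex n F).homology k


/-- The pullback `p^* α` of a form by a map `p : M → N`. -/
def pullbackForm {m : ℕ} {N : Type u} [TopologicalSpace N]
    [ChartedSpace (EuclideanSpace ℝ (Fin m)) N] (p : M → N) {k : ℕ} (α : RawForm m N k) :
    RawForm n M k := fun x =>
  (α (p x)).compContinuousLinearMap (mfderiv (𝓡 n) (𝓡 m) p x)

end

section
variable {k n : ℕ} {S M : Type u} [TopologicalSpace S] [ChartedSpace (EuclideanSpace ℝ (Fin k)) S]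
  [TopologicalSpace M] [ChartedSpace (EuclideanSpace ℝ (Fin n)) M]

variable (k n) in
/-- An injective immersion `ι : S → M` which identifies the manifold diffeology of `S` with the
subspace diffeology of its image: a map from an open subset of a Cartesian space to `S` is smooth if
and only if it is smooth as a map to `M`. -/
structure IsWeakEmbedding (ι : S → M) : Prop where
  injective : Function.Injective ι
  isImmersion : Manifold.IsImmersion (𝓡 k) (𝓡 n) ∞ ι
  plots : ∀ (d : ℕ) (U : Set (EuclideanSpace ℝ (Fin d))) (f : EuclideanSpace ℝ (Fin d) → S),
    IsOpen U → (ContMDiffOn (𝓡 d) (𝓡 k) ∞ f U ↔ ContMDiffOn (𝓡 d) (𝓡 n) ∞ (ι ∘ f) U)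

theorem mk_congr {S : Type*} [TopologicalSpace S] [ChartedSpace (EuclideanSpace ℝ (Fin k)) S]
    (v : EuclideanSpace ℝ (Fin k)) {a b : S} (h : a = b) :
    (⟨a, v⟩ : TangentBundle (𝓡 k) S) = ⟨b, v⟩ := by
  subst h; rfl

theorem exists_model_curve {V : Type*} [NormedAddCommGroup V] [NormedSpace ℝ V]
    {O : Set V} (hO : IsOpen O) {y : V} (hy : y ∈ O) (w : V) :
    ∃ f : ℝ → V, ContDiff ℝ ∞ f ∧ (∀ t, f t ∈ O) ∧ f 0 = y ∧ HasDerivAt f w 0 := by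
  obtain ⟨ε, hε, hball⟩ := Metric.isOpen_iff.1 hO y hy
  have hw1 : 0 < ‖w‖ + 1 := by positivity
  obtain ⟨r, hr⟩ : ∃ r : ℝ, r = ε / (‖w‖ + 1) := ⟨_, rfl⟩
  have hr0 : 0 < r := by rw [hr]; positivity
  refine ⟨fun t => y + (r * Real.sin (t / r)) • w, by fun_prop, fun t => hball ?_, by simp, ?_⟩
  · rw [Metric.mem_ball, dist_eq_norm]
    simp only [add_sub_cancel_left, norm_smul, norm_mul, Real.norm_eq_abs, abs_of_pos hr0]
    have h1 : r * |Real.sin (t / r)| * ‖w‖ ≤ r * ‖w‖ := by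
      gcongr
      exact mul_le_of_le_one_right hr0.le (Real.abs_sin_le_one _)
    have h2 : r * (‖w‖ + 1) = ε := by rw [hr]; field_simp
    linarith
  · have h1 : HasDerivAt (fun t : ℝ => r * Real.sin (t / r)) 1 0 := by
      have h := ((Real.hasDerivAt_sin ((0 : ℝ) / r)).comp 0
        ((hasDerivAt_id (0 : ℝ)).div_const r)).const_mul r
      simpa [hr0.ne', Function.comp_def] using h
    simpa using (h1.smul_const w).const_add y

/-- Every tangent vector of a manifold is the velocity of a smooth curve. -/
theorem exists_curve [IsManifold (𝓡 k) ∞ S] (s : S) (w : TangentSpace (𝓡 k) s) :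
    ∃ σ : ℝ → S, ContMDiff 𝓘(ℝ, ℝ) (𝓡 k) ∞ σ ∧
      tangentMap 𝓘(ℝ, ℝ) (𝓡 k) σ ⟨0, (1 : ℝ)⟩ = ⟨s, w⟩ := by
  let w' : EuclideanSpace ℝ (Fin k) := w
  obtain ⟨f, hf, hft, h0, hf'⟩ := exists_model_curve (isOpen_extChartAt_target (I := 𝓡 k) s)
    (mem_extChartAt_target s) w'
  have hsy : ∀ y ∈ (extChartAt (𝓡 k) s).target,
      ContMDiffAt 𝓘(ℝ, EuclideanSpace ℝ (Fin k)) (𝓡 k) ∞ (extChartAt (𝓡 k) s).symm y :=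
    fun y hy => (contMDiffOn_extChartAt_symm (n := ∞) s).contMDiffAt
      ((isOpen_extChartAt_target s).mem_nhds hy)
  refine ⟨(extChartAt (𝓡 k) s).symm ∘ f, fun t => (hsy _ (hft t)).comp t
    hf.contMDiff.contMDiffAt, ?_⟩
  rw [tangentMap_comp_at _ ((hsy _ (hft 0)).mdifferentiableAt (by simp))
    (hf.contMDiff.contMDiffAt.mdifferentiableAt (by simp))]
  have h1 : tangentMap 𝓘(ℝ, ℝ) 𝓘(ℝ, EuclideanSpace ℝ (Fin k)) f ⟨0, (1 : ℝ)⟩ =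
      ⟨extChartAt (𝓡 k) s s, w'⟩ := by
    have h2 : mfderiv 𝓘(ℝ, ℝ) 𝓘(ℝ, EuclideanSpace ℝ (Fin k)) f 0 (1 : ℝ) = w' := by
      rw [mfderiv_eq_fderiv]
      exact hf'.deriv
    refine Eq.trans ?_ (mk_congr w' h0)
    exact congrArg (fun q => (⟨f 0, q⟩ : TangentBundle _ (EuclideanSpace ℝ (Fin k)))) h2
  rw [h1]
  have h3 := mfderivWithin_range_extChartAt_symm (I := 𝓡 k) (x := s)
  rw [ModelWithCorners.range_eq_univ, mfderivWithin_univ] at h3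
  refine Eq.trans ?_ (mk_congr w' (extChartAt_to_inv (I := 𝓡 k) s))
  exact congrArg (fun q => (⟨(extChartAt (𝓡 k) s).symm (extChartAt (𝓡 k) s s), q⟩ :
    TangentBundle (𝓡 k) S)) (congrArg (fun A => A w') h3)

/-- The tangent space of a weakly-embedded leaf is the image of the derivative of its inclusion. -/
theorem mem_leafTangent_iff [IsManifold (𝓡 k) ∞ S] [IsManifold (𝓡 n) ∞ M] {F : Setoid M} {ι : S → M}
    (hι : IsWeakEmbedding k n ι) {x : M} (hr : Set.range ι = {y | F y x}) {s : S} (hs : ι s = x)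
    (v : TangentSpace (𝓡 n) x) :
    v ∈ leafTangent n F x ↔
      ∃ w : TangentSpace (𝓡 k) s, tangentMap (𝓡 k) (𝓡 n) ι ⟨s, w⟩ = ⟨x, v⟩ := by
  have hsm : ContMDiff (𝓡 k) (𝓡 n) ∞ ι := hι.isImmersion.contMDiff
  constructor
  · rintro ⟨γ, hγ, hF, hv⟩
    have hex : ∀ t, ∃ q : S, ι q = γ t := fun t => by
      have : γ t ∈ Set.range ι := by rw [hr]; exact hF t
      exact this
    choose σ hσ using hex
    let L : EuclideanSpace ℝ (Fin 1) →L[ℝ] ℝ := EuclideanSpace.proj 0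
    have h1 : ContMDiffOn (𝓡 1) (𝓡 k) ∞ (σ ∘ L) Set.univ := by
      rw [hι.plots 1 Set.univ _ isOpen_univ]
      have : ι ∘ σ ∘ L = γ ∘ L := funext fun t => hσ _
      rw [this]
      exact (hγ.comp L.contDiff.contMDiff).contMDiffOn
    let R : ℝ →L[ℝ] EuclideanSpace ℝ (Fin 1) :=
      (1 : ℝ →L[ℝ] ℝ).smulRight (EuclideanSpace.single 0 1)
    have h2 : ContMDiff 𝓘(ℝ, ℝ) (𝓡 k) ∞ σ := by
      have h3 := (contMDiffOn_univ.1 h1).comp R.contDiff.contMDiff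
      have : (σ ∘ L) ∘ R = σ := by funext t; simp [L, R]
      rwa [this] at h3
    have h4 : σ 0 = s := by
      apply hι.injective
      rw [hσ, hs]
      exact congrArg (fun q : TangentBundle (𝓡 n) M => q.1) hv
    have hcomp : ι ∘ σ = γ := funext hσ
    subst h4
    refine ⟨(tangentMap 𝓘(ℝ, ℝ) (𝓡 k) σ ⟨0, (1 : ℝ)⟩).2, ?_⟩
    rw [← hv, ← hcomp]
    exact (congrFun (tangentMap_comp (hsm.mdifferentiable (by simp))
      (h2.mdifferentiable (by simp))) ⟨0, (1 : ℝ)⟩).symm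
  · rintro ⟨w, hw⟩
    obtain ⟨σ, h1, h2⟩ := exists_curve s w
    refine ⟨ι ∘ σ, hsm.comp h1, fun t => ?_, ?_⟩
    · have : ι (σ t) ∈ Set.range ι := ⟨_, rfl⟩
      rwa [hr] at this
    · rw [← hw, ← h2]
      exact congrFun (tangentMap_comp (hsm.mdifferentiable (by simp))
        (h1.mdifferentiable (by simp))) ⟨0, (1 : ℝ)⟩

variable (n) in
/-- `L` is a connected weakly-embedded submanifold of `M`, of dimension `k`. Both the topology and the
smooth structure of `L` are those of the manifold `S`, and are finer than the subspace topology in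
general. -/
def IsConnectedWeaklyEmbedded (k : ℕ) (L : Set M) : Prop :=
  ∃ (S : Type u) (_ : TopologicalSpace S) (_ : ChartedSpace (EuclideanSpace ℝ (Fin k)) S)
    (ι : S → M), IsManifold (𝓡 k) ∞ S ∧ T2Space S ∧ SecondCountableTopology S ∧
      ConnectedSpace S ∧ IsWeakEmbedding k n ι ∧ Set.range ι = L

variable (n) in
/-- A chart `ψ : V → U × W` centred at `x`, with `U` and `W` open in `ℝᵏ` and `ℝⁿ⁻ᵏ`, which takes
each leaf `L` to a set `U × l`. -/
def HasStefanChart (k : ℕ) (F : Setoid M) (x : M) : Prop :=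
  ∃ (ψ : OpenPartialHomeomorph M (EuclideanSpace ℝ (Fin k) × EuclideanSpace ℝ (Fin (n - k))))
    (U : Set (EuclideanSpace ℝ (Fin k))) (W : Set (EuclideanSpace ℝ (Fin (n - k)))),
    ContMDiffOn (𝓡 n) 𝓘(ℝ, EuclideanSpace ℝ (Fin k) × EuclideanSpace ℝ (Fin (n - k))) ∞
      ψ ψ.source ∧
    ContMDiffOn 𝓘(ℝ, EuclideanSpace ℝ (Fin k) × EuclideanSpace ℝ (Fin (n - k))) (𝓡 n) ∞
      ψ.symm ψ.target ∧
    IsOpen U ∧ IsOpen W ∧ ψ.target = U ×ˢ W ∧ x ∈ ψ.source ∧ ψ x = (0, 0) ∧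
    ∀ y : M, ∃ l ⊆ W, ψ '' ({z | F z y} ∩ ψ.source) = U ×ˢ l

variable (n) in
/-- A (Stefan) singular foliation: a partition into connected weakly-embedded submanifolds with such a
chart about each point `x`, where `k` is the dimension of the leaf through `x`. -/
def IsSingularFoliation (F : Setoid M) : Prop :=
  ∀ x : M, ∃ k : ℕ, IsConnectedWeaklyEmbedded n k {y | F y x} ∧ HasStefanChart n k F x

variable (k n) in
/-- Surjective submersions with connected fibers. -/
structure IsConnectedFiberSubmersion (p : S → M) : Prop where
  isSubmersion : Manifold.IsSubmersion (𝓡 k) (𝓡 n) ∞ p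
  surjective : Function.Surjective p
  connected_fiber : ∀ y, IsConnected (p ⁻¹' {y})

/-- Molino transverse equivalence. The pullback `p⁻¹ F` of a partition has the leaves `p⁻¹ (L)`, that
is, it is `F.comap p`. -/
def IsMolinoEquivalent (n₀ n₁ : ℕ) {N₀ N₁ : Type u}
    [TopologicalSpace N₀] [ChartedSpace (EuclideanSpace ℝ (Fin n₀)) N₀]
    [TopologicalSpace N₁] [ChartedSpace (EuclideanSpace ℝ (Fin n₁)) N₁]
    (F₀ : Setoid N₀) (F₁ : Setoid N₁) : Prop :=
  ∃ (m : ℕ) (M : Type u) (_ : TopologicalSpace M) (_ : ChartedSpace (EuclideanSpace ℝ (Fin m)) M)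
    (F : Setoid M) (p₀ : M → N₀) (p₁ : M → N₁),
    IsManifold (𝓡 m) ∞ M ∧ T2Space M ∧ SecondCountableTopology M ∧ IsSingularFoliation m F ∧
    IsConnectedFiberSubmersion m n₀ p₀ ∧ IsConnectedFiberSubmersion m n₁ p₁ ∧
    F₀.comap p₀ = F ∧ F₁.comap p₁ = F

end
end Foliation
end

open CategoryTheory Foliation

/-! For a form with `ι_X α = 0`, Cartan's formula reads `L_X α = ι_X dα`. Hence a smooth form is
basic exactly when both it and its differential are horizontal, that is, killed by every tangent
field (`isBasic_iff`). Lie derivatives disappear, and since `d` commutes with pullbacks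
(`rawD_pullbackForm`), only horizontality has to be compared on `M` and on `N`.

Horizontality is a pointwise condition, so fields need to correspond only at one point at a time. A
field tangent to `p⁻¹ F` is restricted along a local section, pushed down and cut off
(`exists_isTangentField_push`). A field tangent to `F` lifts in a chart where `p` is a linear
projection, with any prescribed lift at one point (`exists_isTangentField_lift`). Thus `p^* α` is
basic if and only if `α` is. Injectivity of `p^*` holds because `p` is onto and its derivatives have
right inverses.

For surjectivity, let `β` be basic on `M`. Lifts of the zero field give every vertical vector as a
value of a tangent field, so `β` and `dβ` are killed by vertical vectors. In a fibered chart,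
Cartan's formula for a constant vertical field then makes the coefficients of `β` constant along the
fibers (`FiberedChart.eventually_pullModel_eq`). At each point `β` is the pullback of a form on the
tangent space of `N`. Which form this is depends locally constantly on the point of the fiber, so it
is the same on a whole connected fiber. This defines `α` with `p^* α = β`, and `α` is smooth because
locally it is the pullback of `β` by a section of `p`.

A Molino equivalence is a span of two such submersions with the same pulled-back partition, so the
second claim follows by composing one isomorphism with the inverse of the other. -/

namespace ContinuousAlternatingMap

/-! ### Smooth dependence of the pullback of alternating forms on the linear map -/

variable {E E' G : Type*} [NormedAddCommGroup E] [NormedSpace ℝ E] [NormedAddCommGroup E']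
  [NormedSpace ℝ E'] [NormedAddCommGroup G] [NormedSpace ℝ G]

/-- The sum over permutations has `k!` terms, each bounded by `‖f‖ ∏ ‖v i‖`. Continuity makes
alternatization a smooth way from multilinear to alternating maps. -/
theorem continuous_alternatization (k : ℕ) : Continuous
    (ContinuousMultilinearMap.alternatization (R := ℝ) (M := E) (N := G) (ι := Fin k)) := by
  refine AddMonoidHomClass.continuous_of_bound _ (Fintype.card (Equiv.Perm (Fin k)) : ℝ)
    fun f => ?_
  refine ContinuousAlternatingMap.opNorm_le_bound _ (by positivity) fun v => ?_
  rw [ContinuousMultilinearMap.alternatization_apply_apply]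
  refine (norm_sum_le _ _).trans ?_
  have h : ∀ σ ∈ (Finset.univ : Finset (Equiv.Perm (Fin k))),
      ‖Equiv.Perm.sign σ • f (v ∘ σ)‖ ≤ ‖f‖ * ∏ i, ‖v i‖ := by
    intro σ _
    have h1 : ‖Equiv.Perm.sign σ • f (v ∘ σ)‖ = ‖f (v ∘ σ)‖ := by
      rcases Int.units_eq_one_or (Equiv.Perm.sign σ) with h | h <;> simp [h]
    rw [h1]
    refine (f.le_opNorm _).trans (le_of_eq ?_)
    congr 1
    exact Equiv.prod_comp σ fun i => ‖v i‖
  refine (Finset.sum_le_sum h).trans (le_of_eq ?_)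
  rw [Finset.sum_const, nsmul_eq_mul, Finset.card_univ, mul_assoc]

/-- The pullback of alternating forms by linear maps is smooth in both arguments. -/
theorem contDiff_compContinuousLinearMap (k : ℕ) {r : WithTop ℕ∞} :
    ContDiff ℝ r fun q : (E' [⋀^Fin k]→L[ℝ] G) × (E →L[ℝ] E') =>
      q.1.compContinuousLinearMap q.2 := by
  have h1 : ContDiff ℝ r fun q : (E' [⋀^Fin k]→L[ℝ] G) × (E →L[ℝ] E') =>
      ContinuousMultilinearMap.compContinuousLinearMapContinuousMultilinear ℝ
        (fun _ : Fin k => E) (fun _ => E') G (fun _ => q.2)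
        (ContinuousAlternatingMap.toContinuousMultilinearMapCLM ℝ q.1) := by
    refine ContDiff.clm_apply ?_ ?_
    · exact (ContinuousMultilinearMap.contDiff _).comp (contDiff_pi.2 fun _ => contDiff_snd)
    · exact (ContinuousLinearMap.contDiff _).comp contDiff_fst
  -- Alternatization multiplies an alternating map by `k!`. Applying it to the multilinear pullback
  -- and dividing by `k!` returns the pullback, now as a smooth function with values in alternating
  -- maps.
  have h2 := ((AddMonoidHom.toRealLinearMap _
    (continuous_alternatization (E := E) (G := G) k)).contDiff (n := r)).comp h1
  have h3 := h2.const_smul ((k.factorial : ℝ)⁻¹)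
  convert h3 using 1
  funext q
  ext v
  have h4 : ((ContinuousMultilinearMap.alternatization
      (q.1.compContinuousLinearMap q.2).toContinuousMultilinearMap)) v =
      k.factorial • q.1.compContinuousLinearMap q.2 v := by
    rw [ContinuousMultilinearMap.alternatization_apply_apply]
    have : ∀ σ ∈ (Finset.univ : Finset (Equiv.Perm (Fin k))), Equiv.Perm.sign σ •
        (q.1.compContinuousLinearMap q.2).toContinuousMultilinearMap (v ∘ σ) =
          q.1.compContinuousLinearMap q.2 v := by
      intro σ _
      have h5 := (q.1.compContinuousLinearMap q.2).toAlternatingMap.map_perm v σ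
      change (q.1.compContinuousLinearMap q.2) (v ∘ σ) =
        _ • (q.1.compContinuousLinearMap q.2) v at h5
      change Equiv.Perm.sign σ • (q.1.compContinuousLinearMap q.2) (v ∘ σ) = _
      rw [h5, smul_smul, Int.units_mul_self, one_smul]
    rw [Finset.sum_congr rfl this, Finset.sum_const, Finset.card_univ, Fintype.card_perm,
      Fintype.card_fin]
  have hk : (k.factorial : ℝ) ≠ 0 := by exact_mod_cast k.factorial_ne_zero
  change q.1.compContinuousLinearMap q.2 v = (k.factorial : ℝ)⁻¹ •
    (ContinuousMultilinearMap.alternatization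
      (q.1.compContinuousLinearMap q.2).toContinuousMultilinearMap) v
  rw [h4, ← Nat.cast_smul_eq_nsmul ℝ, smul_smul, inv_mul_cancel₀ hk, one_smul]

end ContinuousAlternatingMap

/-! ### Pullbacks of forms to normed spaces -/

noncomputable section

namespace Foliation

section
variable {n : ℕ} {M : Type u} [TopologicalSpace M] [ChartedSpace (EuclideanSpace ℝ (Fin n)) M]
  {V : Type*} [NormedAddCommGroup V] [NormedSpace ℝ V] {k : ℕ}

/-- The pullback of a form on a manifold by a map from a normed space. -/
def pullModel (α : RawForm n M k) (g : V → M) (y : V) : V [⋀^Fin k]→L[ℝ] ℝ :=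
  (α (g y)).compContinuousLinearMap (mfderiv 𝓘(ℝ, V) (𝓡 n) g y)

/-- Rewriting the base point of `α a v` is obstructed by the type of `v`. All tangent spaces unfold
to the model space, so base point and arguments can be changed together when the latter are typed
there. -/
theorem form_congr (α : RawForm n M k) {a b : M} (h : a = b)
    {v w : Fin k → EuclideanSpace ℝ (Fin n)} (h' : v = w) : α a v = α b w := by
  subst h h'; rfl

theorem pullModel_congr (α : RawForm n M k) {g g' : V → M} {y : V} (h : g =ᶠ[𝓝 y] g') :
    pullModel α g y = pullModel α g' y := by
  have key : ∀ (A B : V →L[ℝ] EuclideanSpace ℝ (Fin n)) (_ : A = B) (v : Fin k → V),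
      (fun i => A (v i)) = fun i => B (v i) := by
    rintro A _ rfl v
    rfl
  ext v
  exact form_congr α h.eq_of_nhds (key _ _ h.mfderiv_eq v)

theorem chartRep_eq_pullModel (α : RawForm n M k) (c : M) :
    chartRep α c = pullModel α (extChartAt (𝓡 n) c).symm := rfl

variable [IsManifold (𝓡 n) ∞ M]

theorem contMDiffAt_extChartAt_symm {c : M} {y : EuclideanSpace ℝ (Fin n)}
    (hy : y ∈ (extChartAt (𝓡 n) c).target) :
    ContMDiffAt 𝓘(ℝ, EuclideanSpace ℝ (Fin n)) (𝓡 n) ∞ (extChartAt (𝓡 n) c).symm y :=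
  (contMDiffOn_extChartAt_symm (n := ∞) c).contMDiffAt
    ((isOpen_extChartAt_target c).mem_nhds hy)

theorem contMDiffAt_extChartAt_of_mem {c x : M} (hx : x ∈ (extChartAt (𝓡 n) c).source) :
    ContMDiffAt (𝓡 n) 𝓘(ℝ, EuclideanSpace ℝ (Fin n)) ∞ (extChartAt (𝓡 n) c) x :=
  (contMDiffOn_extChartAt (n := ∞) (x := c)).contMDiffAt
    ((chartAt (EuclideanSpace ℝ (Fin n)) c).open_source.mem_nhds (by simpa using hx))

/-- Near `y`, the map `g` is the inverse chart at `g y` after `g` read in that chart. Fixing this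
one chart turns the pullback into one between normed spaces, where smoothness and `extDeriv` can be
computed. -/
theorem pullModel_eventuallyEq (α : RawForm n M k) {g : V → M} {y : V}
    (hg : ∀ᶠ z in 𝓝 y, ContMDiffAt 𝓘(ℝ, V) (𝓡 n) ∞ g z) :
    pullModel α g =ᶠ[𝓝 y] fun z =>
      (chartRep α (g y) (extChartAt (𝓡 n) (g y) (g z))).compContinuousLinearMap
        (fderiv ℝ (fun w => extChartAt (𝓡 n) (g y) (g w)) z) := by
  have hs : ∀ᶠ z in 𝓝 y, g z ∈ (extChartAt (𝓡 n) (g y)).source :=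
    hg.self_of_nhds.continuousAt.eventually_mem
      ((isOpen_extChartAt_source _).mem_nhds (mem_extChartAt_source _))
  filter_upwards [hg, hs, hs.eventually_nhds] with z hz hzs hzn
  have hτ : MDifferentiableAt 𝓘(ℝ, V) 𝓘(ℝ, EuclideanSpace ℝ (Fin n))
      (fun w => extChartAt (𝓡 n) (g y) (g w)) z :=
    ((contMDiffAt_extChartAt_of_mem hzs).comp z hz).mdifferentiableAt (by simp)
  have hcomp := mfderiv_comp z ((contMDiffAt_extChartAt_symm
    ((extChartAt (𝓡 n) (g y)).map_source hzs)).mdifferentiableAt (by simp)) hτ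
  rw [mfderiv_eq_fderiv] at hcomp
  have hee : g =ᶠ[𝓝 z] (extChartAt (𝓡 n) (g y)).symm ∘ fun w => extChartAt (𝓡 n) (g y) (g w) := by
    filter_upwards [hzn] with w hw
    exact ((extChartAt (𝓡 n) (g y)).left_inv hw).symm
  refine (pullModel_congr α hee).trans ?_
  unfold pullModel
  rw [hcomp]
  rfl

theorem contDiffAt_chart_comp {g : V → M} {y : V} (hg : ContMDiffAt 𝓘(ℝ, V) (𝓡 n) ∞ g y) :
    ContDiffAt ℝ ∞ (fun w => extChartAt (𝓡 n) (g y) (g w)) y := by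
  rw [← contMDiffAt_iff_contDiffAt]
  exact (contMDiffAt_extChartAt_of_mem (mem_extChartAt_source _)).comp y hg

theorem contDiffAt_pullModel {α : RawForm n M k} (hα : IsSmoothForm α) {g : V → M} {y : V}
    (hg : ∀ᶠ z in 𝓝 y, ContMDiffAt 𝓘(ℝ, V) (𝓡 n) ∞ g z) :
    ContDiffAt ℝ ∞ (pullModel α g) y := by
  refine ContDiffAt.congr_of_eventuallyEq ?_ (pullModel_eventuallyEq α hg)
  have h1 := contDiffAt_chart_comp hg.self_of_nhds
  have h2 : ContDiffAt ℝ ∞ (chartRep α (g y)) (extChartAt (𝓡 n) (g y) (g y)) :=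
    (hα _).contDiffAt ((isOpen_extChartAt_target _).mem_nhds (mem_extChartAt_target _))
  exact (ContinuousAlternatingMap.contDiff_compContinuousLinearMap k).contDiffAt.comp y
    ((h2.comp y h1).prodMk (h1.fderiv_right (by simp)))

/-- Through the local expression this is naturality of the Euclidean `extDeriv`, since `rawD` is the
Euclidean differential in any chart. -/
theorem extDeriv_pullModel {α : RawForm n M k} (hα : IsSmoothForm α) {g : V → M} {y : V}
    (hg : ∀ᶠ z in 𝓝 y, ContMDiffAt 𝓘(ℝ, V) (𝓡 n) ∞ g z) :
    extDeriv (pullModel α g) y = pullModel (rawD α) g y := by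
  have h1 := contDiffAt_chart_comp hg.self_of_nhds
  rw [(pullModel_eventuallyEq α hg).extDeriv_eq, (pullModel_eventuallyEq (rawD α) hg).eq_of_nhds,
    chartRep_rawD hα _ (mem_extChartAt_target _)]
  exact extDeriv_pullback (hα.differentiableAt _ (mem_extChartAt_target _)) h1
    (by simpa using WithTop.coe_le_coe.2 (le_top : (2 : ℕ∞) ≤ ⊤))

theorem isSmoothForm_iff {α : RawForm n M k} : IsSmoothForm α ↔
    ∀ c : M, ∀ y ∈ (extChartAt (𝓡 n) c).target, ContDiffAt ℝ ∞ (chartRep α c) y :=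
  forall_congr' fun c => ⟨fun h _ hy => h.contDiffAt ((isOpen_extChartAt_target c).mem_nhds hy),
    fun h _ hy => (h _ hy).contDiffWithinAt⟩

end

/-! ### Pullbacks of forms between manifolds -/

section
variable {m n : ℕ} {M N : Type u} [TopologicalSpace M] [ChartedSpace (EuclideanSpace ℝ (Fin m)) M]
  [IsManifold (𝓡 m) ∞ M]
  [TopologicalSpace N] [ChartedSpace (EuclideanSpace ℝ (Fin n)) N] {k : ℕ}
  {V : Type*} [NormedAddCommGroup V] [NormedSpace ℝ V]

theorem pullModel_pullbackForm (α : RawForm n N k) {p : M → N} {g : V → M} {y : V}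
    (hp : MDifferentiableAt (𝓡 m) (𝓡 n) p (g y)) (hg : MDifferentiableAt 𝓘(ℝ, V) (𝓡 m) g y) :
    pullModel (pullbackForm p α : RawForm m M k) g y = pullModel α (p ∘ g) y := by
  unfold pullModel
  rw [mfderiv_comp y hp hg]
  rfl

variable [IsManifold (𝓡 n) ∞ N] {α : RawForm n N k} {p : M → N}

theorem chartRep_pullbackForm_eventuallyEq (hp : ContMDiff (𝓡 m) (𝓡 n) ∞ p) {c : M}
    {y : EuclideanSpace ℝ (Fin m)} (hy : y ∈ (extChartAt (𝓡 m) c).target) :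
    chartRep (pullbackForm p α : RawForm m M k) c =ᶠ[𝓝 y] pullModel α (p ∘ (extChartAt (𝓡 m) c).symm) := by
  filter_upwards [(isOpen_extChartAt_target c).mem_nhds hy] with z hz
  exact pullModel_pullbackForm α (hp.mdifferentiable (by simp) _)
    ((contMDiffAt_extChartAt_symm hz).mdifferentiableAt (by simp))

theorem eventually_contMDiffAt_comp_extChartAt_symm (hp : ContMDiff (𝓡 m) (𝓡 n) ∞ p) {c : M}
    {y : EuclideanSpace ℝ (Fin m)} (hy : y ∈ (extChartAt (𝓡 m) c).target) :
    ∀ᶠ z in 𝓝 y, ContMDiffAt 𝓘(ℝ, EuclideanSpace ℝ (Fin m)) (𝓡 n) ∞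
      (p ∘ (extChartAt (𝓡 m) c).symm) z := by
  filter_upwards [(isOpen_extChartAt_target c).mem_nhds hy] with z hz
  exact (hp _).comp z (contMDiffAt_extChartAt_symm hz)

theorem IsSmoothForm.pullbackForm (hα : IsSmoothForm α) (hp : ContMDiff (𝓡 m) (𝓡 n) ∞ p) :
    IsSmoothForm (Foliation.pullbackForm p α : RawForm m M k) :=
  isSmoothForm_iff.2 fun _ _ hy => (contDiffAt_pullModel hα
    (eventually_contMDiffAt_comp_extChartAt_symm hp hy)).congr_of_eventuallyEq
    (chartRep_pullbackForm_eventuallyEq hp hy)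

/-- The exterior derivative commutes with pullbacks. -/
theorem rawD_pullbackForm (hα : IsSmoothForm α) (hp : ContMDiff (𝓡 m) (𝓡 n) ∞ p) :
    rawD (pullbackForm p α : RawForm m M k) = pullbackForm p (rawD α) := by
  funext x
  have hx := mem_extChartAt_target (I := 𝓡 m) x
  have h1 : extDeriv (chartRep (pullbackForm p α : RawForm m M k) x) (extChartAt (𝓡 m) x x) =
      chartRep (pullbackForm p (rawD α) : RawForm m M (k + 1)) x (extChartAt (𝓡 m) x x) := by
    rw [(chartRep_pullbackForm_eventuallyEq hp hx).extDeriv_eq]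
    refine Eq.trans ?_ (chartRep_pullbackForm_eventuallyEq hp hx).eq_of_nhds.symm
    exact extDeriv_pullModel hα (eventually_contMDiffAt_comp_extChartAt_symm hp hx)
  have h2 := mfderivWithin_range_extChartAt_symm (I := 𝓡 m) (x := x)
  rw [ModelWithCorners.range_eq_univ, mfderivWithin_univ] at h2
  unfold rawD
  rw [h1]
  ext v
  have h3 := mfderiv_extChartAt_self (I := 𝓡 m) (x := x)
  have h4 : ∀ w : EuclideanSpace ℝ (Fin m), mfderiv 𝓘(ℝ, EuclideanSpace ℝ (Fin m)) (𝓡 m)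
      (extChartAt (𝓡 m) x).symm (extChartAt (𝓡 m) x x)
      (mfderiv (𝓡 m) 𝓘(ℝ, EuclideanSpace ℝ (Fin m)) (extChartAt (𝓡 m) x) x w) = w := by
    intro w
    rw [h3]
    exact DFunLike.congr_fun h2 w
  exact form_congr (pullbackForm p (rawD α)) (extChartAt_to_inv x) (funext fun i => h4 _)

end
end Foliation
end

/-! ### Vectors and vector fields tangent to the leaves -/

noncomputable section

namespace Foliation

section
variable {n : ℕ} {M : Type u} [TopologicalSpace M] [ChartedSpace (EuclideanSpace ℝ (Fin n)) M]
  {V : Type*} [NormedAddCommGroup V] [NormedSpace ℝ V]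

theorem velocity_eq_iff {γ : ℝ → V} {a b : V} :
    tangentMap 𝓘(ℝ, ℝ) 𝓘(ℝ, V) γ ⟨0, (1 : ℝ)⟩ = ⟨a, b⟩ ↔ γ 0 = a ∧ deriv γ 0 = b := by
  constructor
  · intro h
    refine ⟨congrArg (fun q : TangentBundle 𝓘(ℝ, V) V => q.1) h, ?_⟩
    have h2 : mfderiv 𝓘(ℝ, ℝ) 𝓘(ℝ, V) γ 0 (1 : ℝ) = b :=
      congrArg (fun q : TangentBundle 𝓘(ℝ, V) V => (q.2 : V)) h
    rwa [mfderiv_eq_fderiv] at h2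
  · rintro ⟨rfl, rfl⟩
    have h2 : mfderiv 𝓘(ℝ, ℝ) 𝓘(ℝ, V) γ 0 (1 : ℝ) = deriv γ 0 := by
      rw [mfderiv_eq_fderiv]; rfl
    exact congrArg (fun q => (⟨γ 0, q⟩ : TangentBundle 𝓘(ℝ, V) V)) h2

/-- A tangent vector is tangent to the leaf if it is the velocity of a local curve in the leaf. -/
theorem mem_leafTangent_of_local {F : Setoid M} {x : M} {γ : ℝ → M} {O : Set ℝ} (hO : IsOpen O)
    (h0 : (0 : ℝ) ∈ O) (hγ : ContMDiffOn 𝓘(ℝ, ℝ) (𝓡 n) ∞ γ O) (hF : ∀ t ∈ O, F (γ t) x)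
    {v : TangentSpace (𝓡 n) x} (hv : tangentMap 𝓘(ℝ, ℝ) (𝓡 n) γ ⟨0, (1 : ℝ)⟩ = ⟨x, v⟩) :
    v ∈ leafTangent n F x := by
  -- `leafTangent` asks for curves defined on all of `ℝ`. The reparametrization `f` maps `ℝ` into
  -- `O` and has value `0` and derivative `1` at `0`, so the velocity is unchanged.
  obtain ⟨f, hf, hfO, hf0, hf'⟩ := exists_model_curve hO h0 (1 : ℝ)
  have hg : ∀ t ∈ O, ContMDiffAt 𝓘(ℝ, ℝ) (𝓡 n) ∞ γ t := fun t ht => hγ.contMDiffAt (hO.mem_nhds ht)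
  refine ⟨γ ∘ f, fun t => (hg _ (hfO t)).comp t hf.contMDiff.contMDiffAt, fun t => hF _ (hfO t), ?_⟩
  rw [tangentMap_comp_at _ ((hg _ (hfO 0)).mdifferentiableAt (by simp))
    (hf.contMDiff.contMDiffAt.mdifferentiableAt (by simp)),
    velocity_eq_iff.2 ⟨hf0, hf'.deriv⟩, hv]

/-- The curve is traversed at speed `c`. This closure under scaling is what lets tangent fields be
multiplied by bump functions. -/
theorem smul_mem_leafTangent {F : Setoid M} {x : M} {v : TangentSpace (𝓡 n) x}
    (hv : v ∈ leafTangent n F x) (c : ℝ) : c • v ∈ leafTangent n F x := by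
  obtain ⟨γ, hγ, hF, h⟩ := hv
  have hc : ContDiff ℝ ∞ (fun t : ℝ => c * t) := by fun_prop
  refine ⟨γ ∘ fun t => c * t, hγ.comp hc.contMDiff, fun t => hF _, ?_⟩
  rw [tangentMap_comp_at _ (hγ.mdifferentiableAt (by simp))
    (hc.contMDiff.contMDiffAt.mdifferentiableAt (by simp))]
  have h1 : tangentMap 𝓘(ℝ, ℝ) 𝓘(ℝ, ℝ) (fun t : ℝ => c * t) ⟨0, (1 : ℝ)⟩ = ⟨0, c⟩ :=
    velocity_eq_iff.2 ⟨by simp, by simp⟩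
  rw [h1]
  obtain ⟨rfl⟩ : γ 0 = x := congrArg (fun q : TangentBundle (𝓡 n) M => q.1) h
  have h2 : mfderiv 𝓘(ℝ, ℝ) (𝓡 n) γ 0 (1 : ℝ) = v := by
    have := congrArg (fun q : TangentBundle (𝓡 n) M => (q.2 : EuclideanSpace ℝ (Fin n))) h
    exact this
  have h3 : mfderiv 𝓘(ℝ, ℝ) (𝓡 n) γ 0 (c : ℝ) = c • v := by
    rw [← h2]
    have h4 := (mfderiv 𝓘(ℝ, ℝ) (𝓡 n) γ 0 : ℝ →L[ℝ] EuclideanSpace ℝ (Fin n)).map_smul c 1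
    have h5 : (c • (1 : ℝ) : ℝ) = c := by simp
    exact (congrArg (mfderiv 𝓘(ℝ, ℝ) (𝓡 n) γ 0 : ℝ →L[ℝ] EuclideanSpace ℝ (Fin n)) h5.symm).trans h4
  exact congrArg (fun q => (⟨γ 0, q⟩ : TangentBundle (𝓡 n) M)) h3

theorem zero_mem_leafTangent (F : Setoid M) (x : M) :
    (0 : TangentSpace (𝓡 n) x) ∈ leafTangent n F x := by
  refine ⟨fun _ => x, contMDiff_const, fun _ => F.refl x, ?_⟩
  have : mfderiv 𝓘(ℝ, ℝ) (𝓡 n) (fun _ : ℝ => x) 0 (1 : ℝ) = (0 : TangentSpace (𝓡 n) x) := by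
    rw [mfderiv_const]; rfl
  exact congrArg (fun q => (⟨x, q⟩ : TangentBundle (𝓡 n) M)) this

variable [IsManifold (𝓡 n) ∞ M]

/-- A vector field which is smooth near `x` and tangent to `F` there agrees at `x` with a smooth
vector field tangent to `F`. -/
theorem exists_isTangentField_of_local [T2Space M] {F : Setoid M} {x : M} {A : Set M}
    (hA : IsOpen A) (hx : x ∈ A) {X : VField n M}
    (hX : ContMDiffOn (𝓡 n) (𝓡 n).tangent ∞ (fun y => (⟨y, X y⟩ : TangentBundle (𝓡 n) M)) A)
    (hF : ∀ y ∈ A, X y ∈ leafTangent n F y) :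
    ∃ Y : VField n M, IsTangentField F Y ∧ Y x = X x := by
  -- A bump function at `x` supported in `A`: the product `χ X` is smooth everywhere, is `X x` at
  -- `x`, and stays tangent because it is a pointwise multiple of `X` in `A` and zero outside.
  obtain ⟨χ, hχ, -⟩ := (SmoothBumpFunction.nhds_basis_support (I := 𝓡 n)
    (hA.mem_nhds hx)).mem_iff.1 (hA.mem_nhds hx)
  refine ⟨fun y => χ y • X y, ⟨?_, fun y => ?_⟩, ?_⟩
  · exact ContMDiffOn.smul_section_of_tsupport χ.contMDiff.contMDiffOn hA hχ hX
  · by_cases hy : y ∈ A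
    · exact smul_mem_leafTangent (hF y hy) _
    · have h0 : χ y = 0 := image_eq_zero_of_notMem_tsupport fun h => hy (hχ h)
      change χ y • X y ∈ _
      rw [h0, zero_smul]
      exact zero_mem_leafTangent F y
  · change χ x • X x = X x
    rw [χ.eq_one, one_smul]

end

theorem contMDiffOn_tangentMap {m n : ℕ} {M N : Type*} [TopologicalSpace M]
    [ChartedSpace (EuclideanSpace ℝ (Fin m)) M] [TopologicalSpace N]
    [ChartedSpace (EuclideanSpace ℝ (Fin n)) N] [IsManifold (𝓡 m) ∞ M] [IsManifold (𝓡 n) ∞ N]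
    {f : M → N} {s : Set M}
    (hf : ContMDiffOn (𝓡 m) (𝓡 n) ∞ f s) (hs : IsOpen s) :
    ContMDiffOn (𝓡 m).tangent (𝓡 n).tangent ∞ (tangentMap (𝓡 m) (𝓡 n) f)
      (Bundle.TotalSpace.proj ⁻¹' s) := by
  refine (hf.contMDiffOn_tangentMapWithin (m := ∞) (by simp) hs.uniqueMDiffOn).congr fun q hq => ?_
  exact (tangentMapWithin_eq_tangentMap (hs.uniqueMDiffOn _ hq)
    ((hf.contMDiffAt (hs.mem_nhds hq)).mdifferentiableAt (by simp))).symm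

/-! ### Submersions in fibered charts, sections, and transfer of tangent fields -/

section
variable {m n : ℕ} {M N : Type u} [TopologicalSpace M] [ChartedSpace (EuclideanSpace ℝ (Fin m)) M]
  [TopologicalSpace N] [ChartedSpace (EuclideanSpace ℝ (Fin n)) N]

variable (m n) in
/-- Charts about `x` and `p x` in which `p` is a linear projection `π`, with a linear section `j`. -/
structure FiberedChart (p : M → N) (x : M) where
  φ : OpenPartialHomeomorph M (EuclideanSpace ℝ (Fin m))
  ψ : OpenPartialHomeomorph N (EuclideanSpace ℝ (Fin n))
  π : EuclideanSpace ℝ (Fin m) →L[ℝ] EuclideanSpace ℝ (Fin n)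
  j : EuclideanSpace ℝ (Fin n) →L[ℝ] EuclideanSpace ℝ (Fin m)
  contMDiffOn_φ : ContMDiffOn (𝓡 m) (𝓡 m) ∞ φ φ.source
  contMDiffOn_φ_symm : ContMDiffOn (𝓡 m) (𝓡 m) ∞ φ.symm φ.target
  contMDiffOn_ψ : ContMDiffOn (𝓡 n) (𝓡 n) ∞ ψ ψ.source
  contMDiffOn_ψ_symm : ContMDiffOn (𝓡 n) (𝓡 n) ∞ ψ.symm ψ.target
  mem_source : x ∈ φ.source
  mapsTo : ∀ y ∈ φ.source, p y ∈ ψ.source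
  apply_eq : ∀ y ∈ φ.source, ψ (p y) = π (φ y)
  π_j : ∀ u, π (j u) = u

theorem nonempty_fiberedChart [IsManifold (𝓡 m) ∞ M] [IsManifold (𝓡 n) ∞ N] {p : M → N}
    (hp : Manifold.IsSubmersion (𝓡 m) (𝓡 n) ∞ p) (x : M) : Nonempty (FiberedChart m n p x) := by
  have h := hp.isSubmersionAt x
  refine ⟨⟨h.domChart, h.codChart, (ContinuousLinearMap.fst ℝ _ h.complement).comp
      h.equiv.toContinuousLinearMap,
    h.equiv.symm.toContinuousLinearMap.comp (ContinuousLinearMap.inl ℝ _ h.complement),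
    contMDiffOn_of_mem_maximalAtlas h.domChart_mem_maximalAtlas,
    contMDiffOn_symm_of_mem_maximalAtlas h.domChart_mem_maximalAtlas,
    contMDiffOn_of_mem_maximalAtlas h.codChart_mem_maximalAtlas,
    contMDiffOn_symm_of_mem_maximalAtlas h.codChart_mem_maximalAtlas,
    h.mem_domChart_source, fun y hy => h.source_subset_preimage_source hy, fun y hy => ?_,
    fun u => by simp⟩⟩
  have h0 : h.domChart y ∈ (h.domChart.extend (𝓡 m)).target := by
    simpa using h.domChart.map_source hy
  have h1 := h.writtenInCharts h0
  simpa [h.domChart.left_inv hy] using h1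

namespace FiberedChart
variable {p : M → N} {x : M} (C : FiberedChart m n p x)
include C

theorem contMDiffAt_φ {y : M} (hy : y ∈ C.φ.source) : ContMDiffAt (𝓡 m) (𝓡 m) ∞ C.φ y :=
  C.contMDiffOn_φ.contMDiffAt (C.φ.open_source.mem_nhds hy)

theorem contMDiffAt_φ_symm {z : EuclideanSpace ℝ (Fin m)} (hz : z ∈ C.φ.target) :
    ContMDiffAt (𝓡 m) (𝓡 m) ∞ C.φ.symm z :=
  C.contMDiffOn_φ_symm.contMDiffAt (C.φ.open_target.mem_nhds hz)

theorem contMDiffAt_ψ {y : N} (hy : y ∈ C.ψ.source) : ContMDiffAt (𝓡 n) (𝓡 n) ∞ C.ψ y :=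
  C.contMDiffOn_ψ.contMDiffAt (C.ψ.open_source.mem_nhds hy)

theorem contMDiffAt_ψ_symm {z : EuclideanSpace ℝ (Fin n)} (hz : z ∈ C.ψ.target) :
    ContMDiffAt (𝓡 n) (𝓡 n) ∞ C.ψ.symm z :=
  C.contMDiffOn_ψ_symm.contMDiffAt (C.ψ.open_target.mem_nhds hz)

theorem ψ_p_φ_symm {z : EuclideanSpace ℝ (Fin m)} (hz : z ∈ C.φ.target) :
    C.ψ (p (C.φ.symm z)) = C.π z := by
  rw [C.apply_eq _ (C.φ.map_target hz), C.φ.right_inv hz]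

theorem π_mem_target {z : EuclideanSpace ℝ (Fin m)} (hz : z ∈ C.φ.target) :
    C.π z ∈ C.ψ.target := by
  rw [← C.ψ_p_φ_symm hz]
  exact C.ψ.map_source (C.mapsTo _ (C.φ.map_target hz))

theorem p_φ_symm {z : EuclideanSpace ℝ (Fin m)} (hz : z ∈ C.φ.target) :
    p (C.φ.symm z) = C.ψ.symm (C.π z) := by
  rw [← C.ψ_p_φ_symm hz, C.ψ.left_inv (C.mapsTo _ (C.φ.map_target hz))]

/-- The criterion used to lift sections and curves through `p`: it suffices to lift them through the
linear map `π`. -/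
theorem p_φ_symm_eq {z : EuclideanSpace ℝ (Fin m)} (hz : z ∈ C.φ.target) {y : N}
    (hy : y ∈ C.ψ.source) (h : C.π z = C.ψ y) : p (C.φ.symm z) = y := by
  rw [C.p_φ_symm hz, h, C.ψ.left_inv hy]

end FiberedChart

variable [IsManifold (𝓡 m) ∞ M] [IsManifold (𝓡 n) ∞ N] {p : M → N}

/-- A submersion has a local section through each point. -/
theorem exists_local_section (hp : Manifold.IsSubmersion (𝓡 m) (𝓡 n) ∞ p) (x : M) :
    ∃ (B : Set N) (s : N → M), IsOpen B ∧ p x ∈ B ∧ ContMDiffOn (𝓡 n) (𝓡 m) ∞ s B ∧ s (p x) = x ∧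
      ∀ y ∈ B, p (s y) = y := by
  obtain ⟨C⟩ := nonempty_fiberedChart hp x
  -- The affine section of `π` which passes through `φ x`. The section of `p` is defined where `A ∘
  -- ψ` lands in the target of `φ`.
  let A : EuclideanSpace ℝ (Fin n) → EuclideanSpace ℝ (Fin m) := fun u =>
    C.φ x + C.j (u - C.ψ (p x))
  have hA : ContDiff ℝ ∞ A := by fun_prop
  have hAπ : ∀ u, C.π (A u) = u := fun u => by
    simp [A, C.π_j, ← C.apply_eq x C.mem_source]
  have hopen := (hA.continuous.comp_continuousOn C.ψ.continuousOn).isOpen_inter_preimage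
    C.ψ.open_source C.φ.open_target
  have h0 : A (C.ψ (p x)) = C.φ x := by simp [A]
  refine ⟨_, fun y => C.φ.symm (A (C.ψ y)), hopen, ⟨C.mapsTo x C.mem_source, ?_⟩, ?_, ?_, ?_⟩
  · simpa [h0] using C.φ.map_source C.mem_source
  · exact C.contMDiffOn_φ_symm.comp (hA.contMDiff.comp_contMDiffOn
      (C.contMDiffOn_ψ.mono Set.inter_subset_left)) fun y hy => hy.2
  · simp only [h0, C.φ.left_inv C.mem_source]
  · exact fun y hy => C.p_φ_symm_eq hy.2 hy.1 (hAπ _)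

/-- The derivatives of a submersion have linear right inverses. -/
theorem exists_mfderiv_rightInverse (hp : Manifold.IsSubmersion (𝓡 m) (𝓡 n) ∞ p) (x : M) :
    ∃ H : EuclideanSpace ℝ (Fin n) →L[ℝ] EuclideanSpace ℝ (Fin m),
      ∀ v, (mfderiv (𝓡 m) (𝓡 n) p x (H v : EuclideanSpace ℝ (Fin m)) :
        EuclideanSpace ℝ (Fin n)) = v := by
  obtain ⟨B, s, hB, hx, hs, hsx, hps⟩ := exists_local_section hp x
  have h1 : (p ∘ s) =ᶠ[𝓝 (p x)] id := by
    filter_upwards [hB.mem_nhds hx] with y hy using hps y hy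
  have h2 := mfderiv_comp (p x) (hp.contMDiff.mdifferentiable (by simp) (s (p x)))
    ((hs.contMDiffAt (hB.mem_nhds hx)).mdifferentiableAt (by simp))
  rw [h1.mfderiv_eq, mfderiv_id, hsx] at h2
  refine ⟨mfderiv (𝓡 n) (𝓡 m) s (p x), fun v => ?_⟩
  exact (DFunLike.congr_fun h2 v).symm

variable {F : Setoid N}

theorem mfderiv_mem_leafTangent (hp : ContMDiff (𝓡 m) (𝓡 n) ∞ p) {x : M}
    {v : TangentSpace (𝓡 m) x} (hv : v ∈ leafTangent m (F.comap p) x) :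
    mfderiv (𝓡 m) (𝓡 n) p x v ∈ leafTangent n F (p x) := by
  obtain ⟨γ, hγ, hF, h⟩ := hv
  refine ⟨p ∘ γ, hp.comp hγ, hF, ?_⟩
  rw [tangentMap_comp_at _ (hp.mdifferentiableAt (by simp)) (hγ.mdifferentiableAt (by simp)), h]
  rfl

/-- Each vector field tangent to `p⁻¹ F` is at each point related to a vector field tangent
to `F`. -/
theorem exists_isTangentField_push [T2Space N] (hp : Manifold.IsSubmersion (𝓡 m) (𝓡 n) ∞ p)
    {X : VField m M} (hX : IsTangentField (F.comap p) X) (x : M) :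
    ∃ Y : VField n N, IsTangentField F Y ∧ Y (p x) = mfderiv (𝓡 m) (𝓡 n) p x (X x) := by
  obtain ⟨B, s, hB, hx, hs, hsx, hps⟩ := exists_local_section hp x
  -- The field `X` need not be projectable, so only its values along the section are pushed down. As
  -- `s (p x) = x`, this suffices for the relation at `x`.
  let Y : VField n N := fun y =>
    (mfderiv (𝓡 m) (𝓡 n) p (s y) (X (s y)) : EuclideanSpace ℝ (Fin n))
  have hY : ContMDiffOn (𝓡 n) (𝓡 n).tangent ∞ (fun y => (⟨y, Y y⟩ : TangentBundle (𝓡 n) N)) B := by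
    have h3 := ((hp.contMDiff.contMDiff_tangentMap (m := ∞) (by simp)).comp hX.1).comp_contMDiffOn hs
    exact h3.congr fun y hy => mk_congr _ (hps y hy).symm
  have hYF : ∀ y ∈ B, Y y ∈ leafTangent n F y := by
    intro y hy
    have h4 := mfderiv_mem_leafTangent hp.contMDiff (hX.2 (s y))
    have key : ∀ (a : N) (_ : a = y) (v : EuclideanSpace ℝ (Fin n)),
        v ∈ leafTangent n F a → v ∈ leafTangent n F y := by
      rintro _ rfl v h; exact h
    exact key _ (hps y hy) _ h4
  obtain ⟨Y', h1, h2⟩ := exists_isTangentField_of_local hB hx hY hYF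
  refine ⟨Y', h1, h2.trans ?_⟩
  change (mfderiv (𝓡 m) (𝓡 n) p (s (p x)) (X (s (p x))) : EuclideanSpace ℝ (Fin n)) = _
  rw [hsx]

namespace FiberedChart
variable {x : M} (C : FiberedChart m n p x)

/-- The expression of a vector field of `N` in the chart `ψ`, as a function on `N`. -/
def repr (Y : VField n N) (y : N) : EuclideanSpace ℝ (Fin n) :=
  (tangentMap (𝓡 n) (𝓡 n) C.ψ ⟨y, Y y⟩).2

/-- The lift to `M` of a vector field of `N` with the constant vertical component `w`. -/
def lift (Y : VField n N) (w : EuclideanSpace ℝ (Fin m)) : VField m M := fun y =>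
  (mfderiv (𝓡 m) (𝓡 m) C.φ.symm (C.φ y) (C.j (C.repr Y (p y)) + w : EuclideanSpace ℝ (Fin m)) :
    EuclideanSpace ℝ (Fin m))

theorem contMDiffOn_repr {Y : VField n N} (hY : IsSmoothField Y) :
    ContMDiffOn (𝓡 n) 𝓘(ℝ, EuclideanSpace ℝ (Fin n)) ∞ (C.repr Y) C.ψ.source := by
  have h1 : ContMDiffOn (𝓡 n) (𝓡 n).tangent ∞
      (fun y => tangentMap (𝓡 n) (𝓡 n) C.ψ ⟨y, Y y⟩) C.ψ.source :=
    (contMDiffOn_tangentMap C.contMDiffOn_ψ C.ψ.open_source).comp hY.contMDiffOn fun y hy => hy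
  exact (contMDiff_snd_tangentBundle_modelSpace (EuclideanSpace ℝ (Fin n))
    (𝓡 n)).comp_contMDiffOn h1

theorem contMDiffOn_lift (hp : ContMDiff (𝓡 m) (𝓡 n) ∞ p) {Y : VField n N} (hY : IsSmoothField Y)
    (w : EuclideanSpace ℝ (Fin m)) : ContMDiffOn (𝓡 m) (𝓡 m).tangent ∞
      (fun y => (⟨y, C.lift Y w y⟩ : TangentBundle (𝓡 m) M)) C.φ.source := by
  have hD := (C.contMDiffOn_repr hY).comp hp.contMDiffOn C.mapsTo
  have hW : ContMDiffOn (𝓡 m) 𝓘(ℝ, EuclideanSpace ℝ (Fin m)) ∞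
      (fun y => C.j (C.repr Y (p y)) + w) C.φ.source :=
    (C.j.contMDiff.comp_contMDiffOn hD).add contMDiffOn_const
  have hT : ContMDiffOn (𝓡 m) (𝓡 m).tangent ∞ (fun y => (⟨C.φ y, C.j (C.repr Y (p y)) + w⟩ :
      TangentBundle (𝓡 m) (EuclideanSpace ℝ (Fin m)))) C.φ.source := by
    intro y hy
    refine Bundle.contMDiffWithinAt_totalSpace.2 ⟨C.contMDiffOn_φ y hy, ?_⟩
    convert! hW y hy with z
    simp
  refine ((contMDiffOn_tangentMap C.contMDiffOn_φ_symm C.φ.open_target).comp hT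
    fun y hy => C.φ.map_source hy).congr fun y hy => ?_
  exact mk_congr _ (C.φ.left_inv hy).symm

theorem hasDerivAt_ψ_comp {Y : VField n N} {y : N} (hy : y ∈ C.ψ.source) {δ : ℝ → N}
    (hδ : ContMDiff 𝓘(ℝ, ℝ) (𝓡 n) ∞ δ)
    (h : tangentMap 𝓘(ℝ, ℝ) (𝓡 n) δ ⟨0, (1 : ℝ)⟩ = ⟨y, Y y⟩) :
    HasDerivAt (C.ψ ∘ δ) (C.repr Y y) 0 := by
  have h0 : δ 0 = y := congrArg (fun q : TangentBundle (𝓡 n) N => q.1) h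
  have h1 : MDifferentiableAt (𝓡 n) (𝓡 n) C.ψ (δ 0) := by
    rw [h0]; exact (C.contMDiffAt_ψ hy).mdifferentiableAt (by simp)
  have h2 : MDifferentiableAt 𝓘(ℝ, ℝ) (𝓡 n) δ 0 := hδ.mdifferentiableAt (by simp)
  have h3 : tangentMap 𝓘(ℝ, ℝ) (𝓡 n) (C.ψ ∘ δ) ⟨0, (1 : ℝ)⟩ =
      tangentMap (𝓡 n) (𝓡 n) C.ψ (tangentMap 𝓘(ℝ, ℝ) (𝓡 n) δ ⟨0, (1 : ℝ)⟩) :=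
    tangentMap_comp_at _ h1 h2
  rw [h] at h3
  have h4 : deriv (C.ψ ∘ δ) 0 = C.repr Y y := (velocity_eq_iff.1 h3).2
  rw [← h4]
  exact (mdifferentiableAt_iff_differentiableAt.1 (h1.comp 0 h2)).hasDerivAt

/-- If `δ` is a curve in the leaf with velocity `Y (p y)`, move in the chart `φ` by `j` of the
displacement of `ψ ∘ δ` plus `t • w`. Since `π w = 0`, this curve projects to `δ`, so it stays in
the preimage of the leaf, and its velocity is the lift. -/
theorem lift_mem_leafTangent {Y : VField n N} {w : EuclideanSpace ℝ (Fin m)} (hw : C.π w = 0)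
    {y : M} (hy : y ∈ C.φ.source) (hY : Y (p y) ∈ leafTangent n F (p y)) :
    C.lift Y w y ∈ leafTangent m (F.comap p) y := by
  obtain ⟨δ, hδ, hF, h⟩ := hY
  have hδ0 : δ 0 = p y := congrArg (fun q : TangentBundle (𝓡 n) N => q.1) h
  obtain ⟨c, hcdef⟩ : ∃ c : ℝ → EuclideanSpace ℝ (Fin m), c = fun t =>
    C.φ y + C.j (C.ψ (δ t) - C.ψ (p y)) + t • w := ⟨_, rfl⟩
  have hc0 : c 0 = C.φ y := by simp [hcdef, hδ0]
  have hπ : ∀ t, C.π (c t) = C.ψ (δ t) := fun t => by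
    simp [hcdef, hw, C.π_j, C.apply_eq y hy]
  have hB : IsOpen (δ ⁻¹' C.ψ.source) := C.ψ.open_source.preimage hδ.continuous
  have hc : ContMDiffOn 𝓘(ℝ, ℝ) (𝓡 m) ∞ c (δ ⁻¹' C.ψ.source) := by
    have h5 : ContMDiffOn 𝓘(ℝ, ℝ) (𝓡 n) ∞ (C.ψ ∘ δ) (δ ⁻¹' C.ψ.source) :=
      C.contMDiffOn_ψ.comp (hδ.contMDiffOn (s := δ ⁻¹' C.ψ.source)) fun t ht => ht
    have h5' : ContDiffOn ℝ ∞ (C.ψ ∘ δ) (δ ⁻¹' C.ψ.source) := h5.contDiffOn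
    have h6 : ContDiff ℝ ∞ fun q : EuclideanSpace ℝ (Fin n) × ℝ =>
        C.φ y + C.j (q.1 - C.ψ (p y)) + q.2 • w := by fun_prop
    rw [hcdef]
    exact (h6.comp_contDiffOn (h5'.prodMk contDiffOn_id)).contMDiffOn
  have hO := hc.continuousOn.isOpen_inter_preimage hB C.φ.open_target
  have h0 : (0 : ℝ) ∈ δ ⁻¹' C.ψ.source ∩ c ⁻¹' C.φ.target := by
    refine ⟨?_, ?_⟩
    · rw [Set.mem_preimage, hδ0]; exact C.mapsTo y hy
    · rw [Set.mem_preimage, hc0]; exact C.φ.map_source hy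
  have hcm : ContMDiffOn 𝓘(ℝ, ℝ) (𝓡 m) ∞ (C.φ.symm ∘ c)
      (δ ⁻¹' C.ψ.source ∩ c ⁻¹' C.φ.target) :=
    C.contMDiffOn_φ_symm.comp (hc.mono Set.inter_subset_left) fun t ht => ht.2
  refine mem_leafTangent_of_local (F := F.comap p) hO h0 hcm (fun t ht => ?_) ?_
  · have h5 : p (C.φ.symm (c t)) = δ t := C.p_φ_symm_eq ht.2 ht.1 (hπ t)
    have h6 : F (p (C.φ.symm (c t))) (p y) := by rw [h5]; exact hF t
    exact h6
  · have h11 : HasDerivAt c (C.j (C.repr Y (p y)) + w) 0 := by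
      have h12 := C.hasDerivAt_ψ_comp (C.mapsTo y hy) hδ h
      have h13 := (C.j.hasFDerivAt.comp_hasDerivAt 0 (h12.sub_const (C.ψ (p y)))).const_add (C.φ y)
      have h14 := h13.add ((hasDerivAt_id (0 : ℝ)).smul_const w)
      rw [one_smul] at h14
      rw [hcdef]
      exact h14
    have h15 : tangentMap 𝓘(ℝ, ℝ) (𝓡 m) (C.φ.symm ∘ c) ⟨0, (1 : ℝ)⟩ =
        tangentMap (𝓡 m) (𝓡 m) C.φ.symm (tangentMap 𝓘(ℝ, ℝ) (𝓡 m) c ⟨0, (1 : ℝ)⟩) :=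
      tangentMap_comp_at _ ((C.contMDiffAt_φ_symm h0.2).mdifferentiableAt (by simp))
        ((hc.contMDiffAt (hB.mem_nhds h0.1)).mdifferentiableAt (by simp))
    rw [h15, velocity_eq_iff.2 ⟨hc0, h11.deriv⟩]
    exact mk_congr _ (C.φ.left_inv hy)

theorem mfderiv_φ_symm_φ {y : M} (hy : y ∈ C.φ.source) (v : EuclideanSpace ℝ (Fin m)) :
    (mfderiv (𝓡 m) (𝓡 m) C.φ.symm (C.φ y) (mfderiv (𝓡 m) (𝓡 m) C.φ y v) :
      EuclideanSpace ℝ (Fin m)) = v := by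
  have h4 : (C.φ.symm ∘ C.φ) =ᶠ[𝓝 y] id := by
    filter_upwards [C.φ.open_source.mem_nhds hy] with y hy using C.φ.left_inv hy
  have h5 := mfderiv_comp y ((C.contMDiffAt_φ_symm (C.φ.map_source hy)).mdifferentiableAt
    (by simp)) ((C.contMDiffAt_φ hy).mdifferentiableAt (by simp))
  rw [h4.mfderiv_eq, mfderiv_id] at h5
  exact (DFunLike.congr_fun h5 v).symm

/-- The derivative of `ψ ∘ p = π ∘ φ`; it identifies which vectors are vertical in the chart. -/
theorem π_mfderiv_φ (hp : ContMDiff (𝓡 m) (𝓡 n) ∞ p) {y : M} (hy : y ∈ C.φ.source)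
    (v : EuclideanSpace ℝ (Fin m)) :
    C.π (mfderiv (𝓡 m) (𝓡 m) C.φ y v) =
      mfderiv (𝓡 n) (𝓡 n) C.ψ (p y) (mfderiv (𝓡 m) (𝓡 n) p y v) := by
  have h1 : (C.ψ ∘ p) =ᶠ[𝓝 y] C.π ∘ C.φ := by
    filter_upwards [C.φ.open_source.mem_nhds hy] with z hz using C.apply_eq z hz
  have h2 := mfderiv_comp y ((C.contMDiffAt_ψ (C.mapsTo y hy)).mdifferentiableAt
    (by simp)) (hp.mdifferentiableAt (x := y) (by simp))
  have h3 := mfderiv_comp y (C.π.contMDiff.mdifferentiableAt (n := ∞) (by simp))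
    ((C.contMDiffAt_φ hy).mdifferentiableAt (by simp))
  rw [h1.mfderiv_eq, h3, mfderiv_eq_fderiv, C.π.fderiv] at h2
  exact DFunLike.congr_fun h2 v

end FiberedChart

/-- Each vector field tangent to `F` lifts to a vector field tangent to `p⁻¹ F`, with any prescribed
lift at one point. -/
theorem exists_isTangentField_lift [T2Space M] (hp : Manifold.IsSubmersion (𝓡 m) (𝓡 n) ∞ p)
    {Y : VField n N} (hY : IsTangentField F Y) {x : M} {v : TangentSpace (𝓡 m) x}
    (hv : mfderiv (𝓡 m) (𝓡 n) p x v = Y (p x)) :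
    ∃ X : VField m M, IsTangentField (F.comap p) X ∧ X x = v := by
  obtain ⟨C⟩ := nonempty_fiberedChart hp x
  let v' : EuclideanSpace ℝ (Fin m) := mfderiv (𝓡 m) (𝓡 m) C.φ x v
  -- The vertical component is chosen so that the lift takes the value `v` at `x`. It is vertical
  -- because `v` projects to `Y (p x)`.
  have hw : C.π (v' - C.j (C.repr Y (p x))) = 0 := by
    have h4 : C.π v' = mfderiv (𝓡 n) (𝓡 n) C.ψ (p x) (mfderiv (𝓡 m) (𝓡 n) p x v) :=
      C.π_mfderiv_φ hp.contMDiff C.mem_source v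
    rw [hv] at h4
    rw [map_sub, C.π_j, h4]
    exact sub_self _
  obtain ⟨X, h1, h2⟩ := exists_isTangentField_of_local C.φ.open_source C.mem_source
    (C.contMDiffOn_lift hp.contMDiff hY.1 _)
    fun y hy => C.lift_mem_leafTangent hw hy (hY.2 (p y))
  refine ⟨X, h1, h2.trans (Eq.trans ?_ (C.mfderiv_φ_symm_φ C.mem_source v))⟩
  unfold FiberedChart.lift
  rw [add_sub_cancel]

end
end Foliation
end

/-! ### Alternating forms and their differentials in vertical directions -/

noncomputable section

namespace Foliation

section
variable {E E' : Type*} [NormedAddCommGroup E] [NormedSpace ℝ E] [NormedAddCommGroup E']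
  [NormedSpace ℝ E'] {k : ℕ}

/-- By antisymmetry the argument in `K` can be moved to the front, at the cost of a sign. -/
theorem map_eq_zero_of_cons {f : E [⋀^Fin (k + 1)]→L[ℝ] ℝ} {K : Set E}
    (h : ∀ u ∈ K, ∀ w : Fin k → E, f (Fin.cons u w : Fin (k + 1) → E) = 0)
    (v : Fin (k + 1) → E) (i : Fin (k + 1)) (hi : v i ∈ K) : f v = 0 := by
  rw [← Fin.insertNth_self_removeNth i v, ContinuousAlternatingMap.map_insertNth]
  have h1 : f (Matrix.vecCons (v i) (i.removeNth v)) = 0 := h _ hi _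
  rw [h1, smul_zero]

/-- An alternating form which vanishes as soon as one argument lies in the kernel of a linear map
depends only on the images of its arguments. -/
theorem map_eq_of_forall_apply_eq {f : E [⋀^Fin k]→L[ℝ] ℝ} {A : E →L[ℝ] E'}
    (h : ∀ (v : Fin k → E) (i : Fin k), A (v i) = 0 → f v = 0) {v w : Fin k → E}
    (hvw : ∀ i, A (v i) = A (w i)) : f v = f w := by
  -- The arguments are exchanged one at a time; each exchange alters the value by `f` with `v i - w
  -- i` in one slot, which lies in the kernel.
  have key : ∀ s : Finset (Fin k), f (s.piecewise v w) = f w := by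
    intro s
    induction s using Finset.induction_on with
    | empty => simp
    | insert i s hi ih =>
      rw [Finset.piecewise_insert, ← ih]
      have h1 : f (Function.update (s.piecewise v w) i (v i - w i)) = 0 :=
        h _ i (by simp [hvw])
      rw [ContinuousAlternatingMap.map_update_sub, sub_eq_zero] at h1
      rw [h1]
      congr 1
      rw [Function.update_eq_self_iff]
      simp [hi]
  simpa using key Finset.univ

/-- A form which, like its differential, is killed by a constant vector field is constant in its
direction. -/
theorem fderiv_apply_eq_zero_of_cons {a : E → E [⋀^Fin k]→L[ℝ] ℝ} {z w : E}
    (ha : DifferentiableAt ℝ a z)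
    (h0 : ∀ᶠ z' in 𝓝 z, ∀ (v : Fin k → E) (i : Fin k), v i = w → a z' v = 0)
    (h1 : ∀ (v : Fin (k + 1) → E) (i : Fin (k + 1)), v i = w → extDeriv a z v = 0) :
    fderiv ℝ a z w = 0 := by
  ext v
  -- Cartan's formula for the constant field `w`. The terms containing the derivative of the field
  -- vanish, so the Lie derivative is the directional derivative of `a`.
  have h2 : extDeriv a z (Fin.cons w v : Fin (k + 1) → E) = modelLie (fun _ => w) a z v := by
    cases k with
    | zero => exact modelLie_zero_form (X := fun _ => w) v
    | succ k =>
      refine modelLie_eq (X := fun _ => w) (differentiableAt_const _) ha ?_ v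
      filter_upwards [h0] with z' hz' v using hz' _ 0 rfl
  rw [h1 _ 0 rfl] at h2
  have h3 : ∀ i, a z (Function.update v i 0) = 0 := fun i => (a z).map_update_zero v i
  simpa [modelLie, h3] using h2.symm

/-- The restriction of `f` to the segment from `z` to `z'` has zero derivative. -/
theorem eq_of_fderiv_apply_sub_eq_zero {G : Type*} [NormedAddCommGroup G] [NormedSpace ℝ G]
    {s : Set E} (hs : Convex ℝ s) {f : E → G} (hf : ∀ z ∈ s, DifferentiableAt ℝ f z)
    {z z' : E} (hz : z ∈ s) (hz' : z' ∈ s) (h : ∀ y ∈ s, fderiv ℝ f y (z' - z) = 0) :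
    f z' = f z := by
  have hmem : ∀ t ∈ Set.Icc (0 : ℝ) 1, z + t • (z' - z) ∈ s := fun t ht =>
    hs.add_smul_sub_mem hz hz' ht
  have hd : ∀ t ∈ Set.Icc (0 : ℝ) 1, HasDerivAt (fun t : ℝ => f (z + t • (z' - z))) 0 t := by
    intro t ht
    have h1 : HasDerivAt (fun t : ℝ => z + t • (z' - z)) (z' - z) t := by
      simpa using ((hasDerivAt_id t).smul_const (z' - z)).const_add z
    have h2 := (hf _ (hmem t ht)).hasFDerivAt.comp_hasDerivAt t h1
    rwa [h _ (hmem t ht)] at h2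
  have h3 := constant_of_has_deriv_right_zero
    (fun t ht => (hd t ht).continuousAt.continuousWithinAt)
    (fun t ht => (hd t ⟨ht.1, ht.2.le⟩).hasDerivWithinAt) 1 ⟨zero_le_one, le_rfl⟩
  simpa using h3

end

/-! ### Basic forms as horizontal forms with horizontal differential -/

section
variable {n : ℕ} {M : Type u} [TopologicalSpace M] [ChartedSpace (EuclideanSpace ℝ (Fin n)) M]
  [IsManifold (𝓡 n) ∞ M] {k : ℕ} {F : Setoid M}

/-- A form is horizontal if its contractions with vector fields tangent to `F` vanish. -/
def IsHorizontal (F : Setoid M) (α : RawForm n M k) : Prop :=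
  ∀ X : VField n M, IsTangentField F X → ContractionVanishes X α

/-- Cartan's formula replaces `L_X α` by `ι_X dα` once `ι_X α = 0`. What remains is pointwise in
`X`, so that fields related at a single point can be compared. -/
theorem isBasic_iff {α : RawForm n M k} (hα : IsSmoothForm α) :
    IsBasic F α ↔ IsHorizontal F α ∧ IsHorizontal F (rawD α) := by
  refine ⟨fun h => ⟨fun X hX => (h X hX).1, fun X hX =>
    contractionVanishes_rawD hα hX.1 (h X hX).1 (h X hX).2⟩, fun h X hX =>
    ⟨h.1 X hX, fun x v => ?_⟩⟩
  rw [← rawD_cons hα hX.1 (h.1 X hX)]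
  exact h.2 X hX x v

theorem isTangentField_zero : IsTangentField F (0 : VField n M) :=
  ⟨Bundle.contMDiff_zeroSection _ _, fun x => zero_mem_leafTangent F x⟩

end

/-! ### Horizontal and basic forms under pullback -/

section
variable {m n : ℕ} {M N : Type u} [TopologicalSpace M] [ChartedSpace (EuclideanSpace ℝ (Fin m)) M]
  [IsManifold (𝓡 m) ∞ M] [T2Space M]
  [TopologicalSpace N] [ChartedSpace (EuclideanSpace ℝ (Fin n)) N]
  [IsManifold (𝓡 n) ∞ N] [T2Space N] {p : M → N} {F : Setoid N} {k : ℕ}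

theorem pullbackForm_cons (α : RawForm n N (k + 1)) (x : M) (u : TangentSpace (𝓡 m) x)
    (v : Fin k → TangentSpace (𝓡 m) x) :
    (pullbackForm p α : RawForm m M (k + 1)) x (Fin.cons u v : Fin (k + 1) → TangentSpace (𝓡 m) x) =
      α (p x) (Fin.cons (mfderiv (𝓡 m) (𝓡 n) p x u) (fun i => mfderiv (𝓡 m) (𝓡 n) p x (v i)) :
        Fin (k + 1) → TangentSpace (𝓡 n) (p x)) := by
  refine congrArg (α (p x)) (funext fun i => ?_)
  refine Fin.cases ?_ (fun j => ?_) i <;> rfl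

/-- At a given point, the values of fields tangent to `F` lift to values of fields tangent to `p⁻¹
F`, and conversely these project. The remaining arguments on `N` are lifted by a right inverse of
the derivative. -/
theorem isHorizontal_pullbackForm_iff (hp : Manifold.IsSubmersion (𝓡 m) (𝓡 n) ∞ p)
    (hps : Function.Surjective p) {α : RawForm n N k} :
    IsHorizontal (F.comap p) (pullbackForm p α : RawForm m M k) ↔ IsHorizontal F α := by
  cases k with
  | zero => exact ⟨fun _ _ _ => trivial, fun _ _ _ => trivial⟩
  | succ k =>
    refine ⟨fun h Y hY y v => ?_, fun h X hX x v => ?_⟩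
    · obtain ⟨x, rfl⟩ := hps y
      obtain ⟨H, hH⟩ := exists_mfderiv_rightInverse hp x
      obtain ⟨X, hX, hXx⟩ := exists_isTangentField_lift hp hY (hH (Y (p x)))
      have h1 := (pullbackForm_cons α x (X x) fun i => H (v i)).symm.trans (h X hX x _)
      refine Eq.trans (congrArg (α (p x)) (funext fun i => ?_)) h1
      refine Fin.cases ?_ (fun j => ?_) i
      · exact (hH (Y (p x))).symm.trans (congrArg (mfderiv (𝓡 m) (𝓡 n) p x) hXx.symm)
      · exact (hH (v j)).symm
    · obtain ⟨Y, hY, hYx⟩ := exists_isTangentField_push hp hX x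
      rw [pullbackForm_cons, ← hYx]
      exact h Y hY _ _

theorem isBasic_pullbackForm_iff (hp : Manifold.IsSubmersion (𝓡 m) (𝓡 n) ∞ p)
    (hps : Function.Surjective p) {α : RawForm n N k} (hα : IsSmoothForm α) :
    IsBasic (F.comap p) (pullbackForm p α : RawForm m M k) ↔ IsBasic F α := by
  rw [isBasic_iff hα, isBasic_iff (hα.pullbackForm hp.contMDiff),
    rawD_pullbackForm hα hp.contMDiff, isHorizontal_pullbackForm_iff hp hps,
    isHorizontal_pullbackForm_iff hp hps]

theorem pullbackForm_injective (hp : Manifold.IsSubmersion (𝓡 m) (𝓡 n) ∞ p)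
    (hps : Function.Surjective p) :
    Function.Injective (pullbackForm p : RawForm n N k → RawForm m M k) := by
  intro α β h
  funext y
  obtain ⟨x, rfl⟩ := hps y
  obtain ⟨H, hH⟩ := exists_mfderiv_rightInverse hp x
  ext v
  have h1 : α (p x) (fun i => mfderiv (𝓡 m) (𝓡 n) p x (H (v i))) =
      β (p x) (fun i => mfderiv (𝓡 m) (𝓡 n) p x (H (v i))) :=
    congrArg (fun η : RawForm m M k => η x fun i => H (v i)) h
  have h2 : (fun i => mfderiv (𝓡 m) (𝓡 n) p x (H (v i))) = v := funext fun i => hH (v i)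
  rwa [h2] at h1

/-- A horizontal form of `p⁻¹ F` is killed by vertical vectors. -/
theorem IsHorizontal.apply_eq_zero (hp : Manifold.IsSubmersion (𝓡 m) (𝓡 n) ∞ p)
    {β : RawForm m M k} (hβ : IsHorizontal (F.comap p) β) {x : M}
    (v : Fin k → EuclideanSpace ℝ (Fin m)) (i : Fin k)
    (hi : (mfderiv (𝓡 m) (𝓡 n) p x (v i) : EuclideanSpace ℝ (Fin n)) = 0) : β x v = 0 := by
  cases k with
  | zero => exact i.elim0
  | succ k =>
    let f : EuclideanSpace ℝ (Fin m) [⋀^Fin (k + 1)]→L[ℝ] ℝ := β x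
    refine map_eq_zero_of_cons (f := f)
      (K := {u | (mfderiv (𝓡 m) (𝓡 n) p x u : EuclideanSpace ℝ (Fin n)) = 0})
      (fun u hu w => ?_) v i hi
    -- A vertical vector is a lift of the value of the zero field, hence the value of a field
    -- tangent to `p⁻¹ F`.
    obtain ⟨X, hX, hXx⟩ := exists_isTangentField_lift (F := F) (v := u) hp isTangentField_zero hu
    have h1 := hβ X hX x w
    rwa [hXx] at h1

/-! ### Basic forms along the fibers, and descent -/

namespace FiberedChart
variable {x₀ : M} (C : FiberedChart m n p x₀)

theorem mfderiv_p_φ_symm (hp : ContMDiff (𝓡 m) (𝓡 n) ∞ p) {z : EuclideanSpace ℝ (Fin m)}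
    (hz : z ∈ C.φ.target) (w : EuclideanSpace ℝ (Fin m)) :
    (mfderiv (𝓡 m) (𝓡 n) p (C.φ.symm z) (mfderiv (𝓡 m) (𝓡 m) C.φ.symm z w) :
      EuclideanSpace ℝ (Fin n)) = mfderiv (𝓡 n) (𝓡 n) C.ψ.symm (C.π z) (C.π w) := by
  have h1 : (p ∘ C.φ.symm) =ᶠ[𝓝 z] C.ψ.symm ∘ C.π := by
    filter_upwards [C.φ.open_target.mem_nhds hz] with z hz using C.p_φ_symm hz
  have h2 := mfderiv_comp z (hp.mdifferentiableAt (x := C.φ.symm z) (by simp))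
    ((C.contMDiffAt_φ_symm hz).mdifferentiableAt (by simp))
  have h3 := mfderiv_comp z ((C.contMDiffAt_ψ_symm (C.π_mem_target hz)).mdifferentiableAt (by simp))
    (C.π.contMDiff.mdifferentiableAt (n := ∞) (by simp))
  rw [h1.mfderiv_eq, h3, mfderiv_eq_fderiv, C.π.fderiv] at h2
  exact (DFunLike.congr_fun h2 w).symm

theorem mfderiv_p_φ_symm_φ (hp : ContMDiff (𝓡 m) (𝓡 n) ∞ p) {x : M} (hx : x ∈ C.φ.source)
    (w : EuclideanSpace ℝ (Fin m)) :
    (mfderiv (𝓡 m) (𝓡 n) p x (mfderiv (𝓡 m) (𝓡 m) C.φ.symm (C.φ x) w : EuclideanSpace ℝ (Fin m)) :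
      EuclideanSpace ℝ (Fin n)) = mfderiv (𝓡 n) (𝓡 n) C.ψ.symm (C.π (C.φ x)) (C.π w) := by
  have h := C.mfderiv_p_φ_symm hp (C.φ.map_source hx) w
  rwa [C.φ.left_inv hx] at h

theorem eventually_contMDiffAt_φ_symm {z : EuclideanSpace ℝ (Fin m)} (hz : z ∈ C.φ.target) :
    ∀ᶠ z' in 𝓝 z, ContMDiffAt (𝓡 m) (𝓡 m) ∞ C.φ.symm z' := by
  filter_upwards [C.φ.open_target.mem_nhds hz] with z hz using C.contMDiffAt_φ_symm hz

/-- In a fibered chart, a basic form is locally constant along the fibers. -/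
theorem eventually_pullModel_eq (hp : Manifold.IsSubmersion (𝓡 m) (𝓡 n) ∞ p) {β : RawForm m M k}
    (hβ : IsSmoothForm β) (hβF : IsBasic (F.comap p) β) :
    ∀ᶠ z in 𝓝 (C.φ x₀), C.π z = C.π (C.φ x₀) →
      pullModel β C.φ.symm z = pullModel β C.φ.symm (C.φ x₀) := by
  obtain ⟨h0, h1⟩ := (isBasic_iff hβ).1 hβF
  have hd : ∀ z ∈ C.φ.target, DifferentiableAt ℝ (pullModel β C.φ.symm) z := fun z hz =>
    (contDiffAt_pullModel hβ (C.eventually_contMDiffAt_φ_symm hz)).differentiableAt (by simp)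
  have hv : ∀ {l : ℕ} {η : RawForm m M l}, IsHorizontal (F.comap p) η → ∀ z ∈ C.φ.target,
      ∀ (v : Fin l → EuclideanSpace ℝ (Fin m)) (i : Fin l), C.π (v i) = 0 →
        pullModel η C.φ.symm z v = 0 := by
    intro l η hη z hz v i hi
    refine hη.apply_eq_zero hp (fun i => mfderiv (𝓡 m) (𝓡 m) C.φ.symm z (v i)) i ?_
    exact (C.mfderiv_p_φ_symm hp.contMDiff hz (v i)).trans (by rw [hi]; exact map_zero _)
  -- Both `β` and `dβ` are killed by the vertical vector `w`, so the expression of `β` has zero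
  -- derivative in the direction `w`.
  have hD : ∀ z ∈ C.φ.target, ∀ w, C.π w = 0 → fderiv ℝ (pullModel β C.φ.symm) z w = 0 := by
    intro z hz w hw
    refine fderiv_apply_eq_zero_of_cons (hd z hz) ?_ ?_
    · filter_upwards [C.φ.open_target.mem_nhds hz] with z' hz' v i hi
      exact hv h0 z' hz' v i (by rw [hi, hw])
    · intro v i hi
      rw [extDeriv_pullModel hβ (C.eventually_contMDiffAt_φ_symm hz)]
      exact hv h1 z hz v i (by rw [hi, hw])
  -- A ball in the chart is convex, so two of its points in one fiber of `π` are joined by a segment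
  -- in it, with direction in the kernel of `π`.
  obtain ⟨ε, hε, hb⟩ := Metric.isOpen_iff.1 C.φ.open_target _ (C.φ.map_source C.mem_source)
  filter_upwards [Metric.ball_mem_nhds _ hε] with z hz hπ
  exact eq_of_fderiv_apply_sub_eq_zero (convex_ball _ _) (fun y hy => hd y (hb hy))
    (Metric.mem_ball_self hε) hz fun y hy => hD y (hb hy) _ (by rw [map_sub, hπ, sub_self])

end FiberedChart

/-- The form `β` is at `x` the pullback of the alternating form `a` by the derivative of `p`. -/
def DescendsTo (p : M → N) (β : RawForm m M k) (a : EuclideanSpace ℝ (Fin n) [⋀^Fin k]→L[ℝ] ℝ)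
    (x : M) : Prop :=
  ∀ v : Fin k → EuclideanSpace ℝ (Fin m),
    β x v = a fun i => (mfderiv (𝓡 m) (𝓡 n) p x (v i) : EuclideanSpace ℝ (Fin n))

/-- On the right, `x` enters only through the value of the local expression of `β` and through `π (φ
x)`. Near the center of the chart, both are constant along the fiber of `p`. -/
theorem FiberedChart.descendsTo_iff (hp : ContMDiff (𝓡 m) (𝓡 n) ∞ p) {x₀ : M}
    (C : FiberedChart m n p x₀) (β : RawForm m M k)
    (a : EuclideanSpace ℝ (Fin n) [⋀^Fin k]→L[ℝ] ℝ) {x : M} (hx : x ∈ C.φ.source) :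
    DescendsTo p β a x ↔ ∀ v : Fin k → EuclideanSpace ℝ (Fin m),
      pullModel β C.φ.symm (C.φ x) v = a fun i =>
        (mfderiv (𝓡 n) (𝓡 n) C.ψ.symm (C.π (C.φ x)) (C.π (v i)) : EuclideanSpace ℝ (Fin n)) := by
  have h1 : ∀ v : Fin k → EuclideanSpace ℝ (Fin m), pullModel β C.φ.symm (C.φ x) v =
      β x fun i => (mfderiv (𝓡 m) (𝓡 m) C.φ.symm (C.φ x) (v i) : EuclideanSpace ℝ (Fin m)) :=
    fun v => form_congr β (C.φ.left_inv hx) rfl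
  constructor
  · intro h v
    refine (h1 v).trans ((h _).trans ?_)
    exact congrArg a (funext fun i => C.mfderiv_p_φ_symm_φ hp hx (v i))
  · intro h v
    have h2 := (h1 _).symm.trans
      (h fun i => (mfderiv (𝓡 m) (𝓡 m) C.φ x (v i) : EuclideanSpace ℝ (Fin m)))
    have h3 : (fun i => (mfderiv (𝓡 m) (𝓡 m) C.φ.symm (C.φ x)
        (mfderiv (𝓡 m) (𝓡 m) C.φ x (v i)) : EuclideanSpace ℝ (Fin m))) = v :=
      funext fun i => C.mfderiv_φ_symm_φ hx (v i)
    refine (congrArg (β x) h3).symm.trans (h2.trans (congrArg a (funext fun i => ?_)))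
    refine (C.mfderiv_p_φ_symm_φ hp hx _).symm.trans ?_
    exact congrArg (mfderiv (𝓡 m) (𝓡 n) p x) (C.mfderiv_φ_symm_φ hx (v i))

theorem eventually_descendsTo_iff (hp : Manifold.IsSubmersion (𝓡 m) (𝓡 n) ∞ p) {β : RawForm m M k}
    (hβ : IsSmoothForm β) (hβF : IsBasic (F.comap p) β) (x₀ : M)
    (a : EuclideanSpace ℝ (Fin n) [⋀^Fin k]→L[ℝ] ℝ) :
    ∀ᶠ x in 𝓝 x₀, p x = p x₀ → (DescendsTo p β a x ↔ DescendsTo p β a x₀) := by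
  obtain ⟨C⟩ := nonempty_fiberedChart hp x₀
  have hc : ContinuousAt C.φ x₀ := C.φ.continuousAt C.mem_source
  filter_upwards [hc.eventually (C.eventually_pullModel_eq hp hβ hβF),
    C.φ.open_source.mem_nhds C.mem_source] with x hx hxs hpx
  have hπ : C.π (C.φ x) = C.π (C.φ x₀) := by
    rw [← C.apply_eq x hxs, ← C.apply_eq x₀ C.mem_source, hpx]
  rw [C.descendsTo_iff hp.contMDiff β a hxs, C.descendsTo_iff hp.contMDiff β a C.mem_source,
    hx hπ, hπ]

/-- For fixed `a`, descending to `a` is a locally constant property on the fiber, and the fiber is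
connected. -/
theorem descendsTo_of_descendsTo (hp : IsConnectedFiberSubmersion m n p) {β : RawForm m M k}
    (hβ : IsSmoothForm β) (hβF : IsBasic (F.comap p) β)
    {a : EuclideanSpace ℝ (Fin n) [⋀^Fin k]→L[ℝ] ℝ} {x₀ x : M} (hx : p x = p x₀)
    (h : DescendsTo p β a x₀) : DescendsTo p β a x := by
  have hP : PreconnectedSpace (p ⁻¹' {p x₀}) :=
    Subtype.preconnectedSpace (hp.connected_fiber (p x₀)).isPreconnected
  have hl : IsLocallyConstant fun q : p ⁻¹' {p x₀} => DescendsTo p β a q.1 := by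
    rw [IsLocallyConstant.iff_eventually_eq]
    intro q
    filter_upwards [continuous_subtype_val.continuousAt.eventually
      (eventually_descendsTo_iff hp.isSubmersion hβ hβF q.1 a)] with q' hq'
    exact propext (hq' (q'.2.trans q.2.symm))
  exact (hl.apply_eq_of_preconnectedSpace ⟨x₀, rfl⟩ ⟨x, hx⟩).mp h

/-- A raw form whose pullback by a surjective submersion is smooth is smooth. -/
theorem isSmoothForm_of_pullbackForm (hp : Manifold.IsSubmersion (𝓡 m) (𝓡 n) ∞ p)
    (hps : Function.Surjective p) {α : RawForm n N k}
    (h : IsSmoothForm (pullbackForm p α : RawForm m M k)) : IsSmoothForm α := by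
  rw [isSmoothForm_iff]
  intro c z hz
  obtain ⟨x, hx⟩ := hps ((extChartAt (𝓡 n) c).symm z)
  -- On `B` the form `α` is the pullback of `p^* α` by the section `s`, because `p ∘ s` is the
  -- identity there.
  obtain ⟨B, s, hB, hxB, hs, -, hps⟩ := exists_local_section hp x
  rw [hx] at hxB
  have hev : ∀ᶠ z' in 𝓝 z, z' ∈ (extChartAt (𝓡 n) c).target ∧ (extChartAt (𝓡 n) c).symm z' ∈ B :=
    ((isOpen_extChartAt_target c).eventually_mem hz).and
      ((contMDiffAt_extChartAt_symm hz).continuousAt.eventually_mem (hB.mem_nhds hxB))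
  have hg : ∀ᶠ z' in 𝓝 z, ContMDiffAt (𝓡 n) (𝓡 m) ∞ (s ∘ (extChartAt (𝓡 n) c).symm) z' := by
    filter_upwards [hev] with z' hz'
    exact (hs.contMDiffAt (hB.mem_nhds hz'.2)).comp z' (contMDiffAt_extChartAt_symm hz'.1)
  refine (contDiffAt_pullModel h hg).congr_of_eventuallyEq ?_
  filter_upwards [hg, hev.eventually_nhds] with z' hz' hn
  rw [pullModel_pullbackForm α (hp.contMDiff.mdifferentiableAt (by simp))
    (hz'.mdifferentiableAt (by simp)), chartRep_eq_pullModel]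
  refine pullModel_congr α ?_
  filter_upwards [hn] with y hy
  exact (hps _ hy.2).symm

/-- Basic forms of `p⁻¹ F` are pullbacks. -/
theorem exists_pullbackForm_eq (hp : IsConnectedFiberSubmersion m n p) {β : RawForm m M k}
    (hβ : IsSmoothForm β) (hβF : IsBasic (F.comap p) β) :
    ∃ α : RawForm n N k, (pullbackForm p α : RawForm m M k) = β := by
  have h1 : ∀ y : N, ∃ a : EuclideanSpace ℝ (Fin n) [⋀^Fin k]→L[ℝ] ℝ,
      ∀ x, p x = y → DescendsTo p β a x := by
    intro y
    obtain ⟨x₀, rfl⟩ := hp.surjective y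
    obtain ⟨H, hH⟩ := exists_mfderiv_rightInverse hp.isSubmersion x₀
    let f : EuclideanSpace ℝ (Fin m) [⋀^Fin k]→L[ℝ] ℝ := β x₀
    let A : EuclideanSpace ℝ (Fin m) →L[ℝ] EuclideanSpace ℝ (Fin n) := mfderiv (𝓡 m) (𝓡 n) p x₀
    -- The form is read off at one point `x₀` of the fiber by a right inverse `H` of the derivative
    -- of `p`. It descends there because `v i` and `H (A (v i))` have the same image under `A`, and
    -- horizontality makes `β` blind to their difference.
    refine ⟨f.compContinuousLinearMap H,
      fun x hx => descendsTo_of_descendsTo hp hβ hβF hx fun v => ?_⟩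
    refine map_eq_of_forall_apply_eq (f := f) (A := A)
      (fun v i hi => ((isBasic_iff hβ).1 hβF).1.apply_eq_zero hp.isSubmersion v i hi) fun i => ?_
    exact (hH _).symm
  choose a ha using h1
  refine ⟨a, funext fun x => ?_⟩
  ext v
  exact (ha (p x) x rfl v).symm

/-! ### The isomorphism of complexes and the theorem -/

/-- The pullback by `p` is an isomorphism between the basic forms of `F` and of `p⁻¹ F`. -/
def basicPullback (hp : IsConnectedFiberSubmersion m n p) (F : Setoid N) (k : ℕ) :
    basicForms n F k ≃ₗ[ℝ] basicForms m (F.comap p) k :=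
  LinearEquiv.ofBijective
    { toFun := fun α => ⟨pullbackForm p α.1, α.2.1.pullbackForm hp.isSubmersion.contMDiff,
        (isBasic_pullbackForm_iff hp.isSubmersion hp.surjective α.2.1).2 α.2.2⟩
      map_add' := fun _ _ => rfl
      map_smul' := fun _ _ => rfl }
    ⟨fun α β h => Subtype.ext (pullbackForm_injective hp.isSubmersion hp.surjective
        (congrArg Subtype.val h)), fun β => by
      obtain ⟨α, hα⟩ := exists_pullbackForm_eq hp β.2.1 β.2.2
      have hs : IsSmoothForm α := isSmoothForm_of_pullbackForm hp.isSubmersion hp.surjective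
        (hα ▸ β.2.1)
      exact ⟨⟨α, hs, (isBasic_pullbackForm_iff hp.isSubmersion hp.surjective hs).1
        (hα ▸ β.2.2)⟩, Subtype.ext hα⟩⟩

open CategoryTheory in
/-- The pullback by `p` as an isomorphism of complexes. -/
def basicComplexIso (hp : IsConnectedFiberSubmersion m n p) (F : Setoid N) :
    basicComplex n F ≅ basicComplex m (F.comap p) :=
  HomologicalComplex.Hom.isoOfComponents (fun k => (basicPullback hp F k).toModuleIso) (by
    rintro i _ rfl
    simp only [basicComplex, CochainComplex.of_d]
    ext α
    exact congrArg (fun η : RawForm m M (i + 1) => η _ _)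
      (rawD_pullbackForm α.2.1 hp.isSubmersion.contMDiff))

end
end Foliation
end

theorem corollary4 :
    (∀ (m n : ℕ) (M N : Type u)
      [TopologicalSpace M] [ChartedSpace (EuclideanSpace ℝ (Fin m)) M] [IsManifold (𝓡 m) ∞ M]
      [T2Space M] [SecondCountableTopology M]
      [TopologicalSpace N] [ChartedSpace (EuclideanSpace ℝ (Fin n)) N] [IsManifold (𝓡 n) ∞ N]
      [T2Space N] [SecondCountableTopology N]
      (p : M → N) (F : Setoid N),
      IsConnectedFiberSubmersion m n p → IsSingularFoliation n F →
      ∃ e : basicComplex n F ≅ basicComplex m (F.comap p),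
        ∀ (k : ℕ) (α : basicForms n F k),
          ((e.hom.f k).hom α : basicForms m (F.comap p) k).1 = pullbackForm p α.1) ∧
    (∀ (n₀ n₁ : ℕ) (N₀ N₁ : Type u)
      [TopologicalSpace N₀] [ChartedSpace (EuclideanSpace ℝ (Fin n₀)) N₀]
      [IsManifold (𝓡 n₀) ∞ N₀] [T2Space N₀] [SecondCountableTopology N₀]
      [TopologicalSpace N₁] [ChartedSpace (EuclideanSpace ℝ (Fin n₁)) N₁]
      [IsManifold (𝓡 n₁) ∞ N₁] [T2Space N₁] [SecondCountableTopology N₁]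
      (F₀ : Setoid N₀) (F₁ : Setoid N₁),
      IsSingularFoliation n₀ F₀ → IsSingularFoliation n₁ F₁ → IsMolinoEquivalent n₀ n₁ F₀ F₁ →
      Nonempty (basicComplex n₀ F₀ ≅ basicComplex n₁ F₁) ∧
      ∀ k : ℕ, Nonempty (basicCohomology n₀ F₀ k ≅ basicCohomology n₁ F₁ k)) := by

  refine ⟨fun m n M N _ _ _ _ _ _ _ _ _ _ p F hp _ => ⟨basicComplexIso hp F, fun _ _ => rfl⟩, ?_⟩
  rintro n₀ n₁ N₀ N₁ _ _ _ _ _ _ _ _ _ _ F₀ F₁ - - ⟨m, M, _, _, F, p₀, p₁, _, _, _, -, h₀, h₁, rfl, h⟩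
  -- The two pullback isomorphisms end in the complexes of `F₀.comap p₀` and `F₁.comap p₁`, which
  -- are identified by the equality of partitions `h`.
  have e : basicComplex n₀ F₀ ≅ basicComplex n₁ F₁ := basicComplexIso h₀ F₀ ≪≫
    eqToIso (by rw [h]) ≪≫ (basicComplexIso h₁ F₁).symm
  exact ⟨⟨e⟩, fun k => ⟨(HomologicalComplex.homologyFunctor _ _ k).mapIso e⟩⟩
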